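/- **Theorem (Stability).** *Network.* Let $(N_e,E_e)$, $E_e\subseteq N_e\times N_e$, be a finite directed graph of buses and lines, with generator buses $N_e^G\subseteq N_e$ and heat pump buses $H_e\subseteq N_e$. Let $(N_h,E_h)$ be a finite directed graph of heat nodes and heat edges (edge $j$ leads from node $s(j)$ to node $t(j)$), connected as an undirected graph, with mass flows $q_j>0$ satisfying $\sum_{t(j)=k}q_j=\sum_{s(j)=k}q_j$ at every node $k$, and with pairwise disjoint sets $H_h,E_h^G,E_h^L\subseteq E_h$ of heat pump, heat source and heat load edges. Let $j\mapsto k_j$ be a bijection $H_e\to H_h$. The constants $B_{ij}$, $D_j$, $\tau_{e,j}$, $Q_{e,jj}$, $\tau_{h,j}$, $Q_{h,jj}$, the coefficients of performance $C_{o,j}$ and the volumes $V^E_j,V^N_k$ are positive, the inertias satisfy $M_j\ge 0$ (with $M_j=0$ allowed, as for load buses), and the electric loads $p^L_j$ and the heat loads $h^L_j$ $(j\in E_h^L)$ are constant. The state is $x=(\eta,\omega,p^G,T,h^G)$ with $T=\mathrm{col}(T^E,T^N)$, where $\eta$, $\omega$, $p^G$, $T^E$, $T^N$, $h^G$ are indexed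 by $E_e$, $N_e$, $N_e^G$, $E_h$, $N_h$, $E_h^G$. Put $p_{ij}=B_{ij}\sin\eta_{ij}$ and $$\bar T=\frac{\sum_{j\in E_h}V^E_jT^E_j+\sum_{k\in N_h}V^N_kT^N_k}{\sum_{j\in E_h}V^E_j+\sum_{k\in N_h}V^N_k}.$$ *Equations.* Let $p^P_j$, $j\in H_e$, be the electric powers consumed by the heat pumps, and $h^P_{k_j}=C_{o,j}p^P_j$; the quantities $p^G_j,p^P_j,h^G_j,h^P_j,h^L_j$ are $0$ for indices outside $N_e^G,H_e,E_h^G,H_h,E_h^L$ respectively. In both modes $$\dot\eta_{ij}=\omega_i-\omega_j\ \ ((i,j)\in E_e),\qquad \tau_{e,j}\dot p^G_j=-p^G_j-\tfrac1{Q_{e,jj}}\omega_j\ \ (j\in N_e^G),\qquad \tau_{h,j}\dot h^G_j=-h^G_j-\tfrac1{Q_{h,jj}}\bar T\ \ (j\in E_h^G),$$ $$V^E_j\dot T^E_j=q_j\bigl(T^N_{s(j)}-T^E_j\bigr)+h^G_j+h^P_j-h^L_j\ \ (j\in E_h),\qquad V^N_k\dot T^N_k=\sum_{t(j)=k}q_jT^E_j-\Bigl(\sum_{t(j)=k}q_j\Bigr)T^N_k\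 \ (k\in N_h).$$ The swing equation at bus $j$ is $$M_j\dot\omega_j=-p^L_j-p^P_j+p^G_j-D_j\omega_j+\sum_{i\to j}p_{ij}-\sum_{j\to k}p_{jk}.$$ - **Mode 1** (frequency dependent load): the swing equation holds at all $j\in N_e$, and $p^P_j=a_{1,j}\omega_j$ with constants $a_{1,j}>0$ for $j\in H_e$. - **Mode 2** (converter bus): the swing equation holds at all $j\in N_e\setminus H_e$, while for $j\in H_e$ $$0=-p^P_j+\sum_{i\to j}p_{ij}-\sum_{j\to k}p_{jk},\qquad \omega_j=m_j\bar T,$$ with constants $m_j>0$. Here $H_e\cap N_e^G=\emptyset$, $E_h^G\neq\emptyset$, and the ratio $m_j/C_{o,j}$ is the same for all $j\in H_e$ (no restriction if there is a single heat pump bus). *Claim.* In either mode, let $x^*$ be an equilibrium point with $|\eta^*_{ij}|<\pi/2$ for all $(i,j)\in E_e$. Then $x^*$ has an open neighbourhood $U$ such that from every point of $U$ that satisfies the algebraic equations there starts a solution on $[0,\infty)$, and every solution on $[0,\infty)$ that starts in $U$ converges, as $t\to\infty$, to an equilibrium point of the system. -/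

import Mathlib

open Real Filter Topology

noncomputable section

/-- Extension by zero of a family indexed by a finite set. -/
def extendZero {ι : Type*} [DecidableEq ι] {s : Finset ι} (f : s → ℝ) (i : ι) : ℝ :=
  if h : i ∈ s then f ⟨i, h⟩ else 0

/-- A combined heat and power network: an electric power network with buses `Ne`, and a heating
network with nodes `Nh` and edges `Eh`, linked by heat pumps.  All powers and temperatures are
deviations from nominal values, in the per-unit system in which the product of density and specific
heat capacity of water is `1`. -/
structure CHPNetwork (Ne Nh Eh : Type*) [Fintype Ne] [DecidableEq Ne] [Fintype Nh] [DecidableEq Nh]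
    [Fintype Eh] [DecidableEq Eh] where
  /-- transmission lines, as directed pairs of buses -/
  Ee : Finset (Ne × Ne)
  /-- generator buses -/
  NeG : Finset Ne
  /-- buses with a heat pump -/
  He : Finset Ne
  /-- line susceptances -/
  B : Ee → ℝ
  B_pos : ∀ e, 0 < B e
  /-- inertias (zero at buses without inertia, in particular at load buses) -/
  M : Ne → ℝ
  M_nonneg : ∀ j, 0 ≤ M j
  /-- coefficients of the frequency dependent uncontrollable loads -/
  D : Ne → ℝ
  D_pos : ∀ j, 0 < D j
  /-- constant electric loads -/
  pL : Ne → ℝ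
  /-- generator time constants -/
  τe : NeG → ℝ
  τe_pos : ∀ j, 0 < τe j
  /-- generator cost coefficients; the control gains are their inverses -/
  Qe : NeG → ℝ
  Qe_pos : ∀ j, 0 < Qe j
  /-- the node from which the flow through a heat edge originates -/
  src : Eh → Nh
  /-- the node into which the flow through a heat edge injects -/
  tgt : Eh → Nh
  /-- the heating network is connected (as an undirected graph) -/
  connected : (SimpleGraph.fromRel fun k l => ∃ e, src e = k ∧ tgt e = l).Connected
  /-- mass flows -/
  q : Eh → ℝ
  q_pos : ∀ e, 0 < q e
  /-- conservation of mass at every heat node -/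
  q_balance : ∀ k, (∑ e, if tgt e = k then q e else 0) = ∑ e, if src e = k then q e else 0
  /-- volumes of the heat edges and of the heat nodes -/
  V : Eh ⊕ Nh → ℝ
  V_pos : ∀ i, 0 < V i
  /-- heat pump edges -/
  Hh : Finset Eh
  /-- conventional heat source edges -/
  EhG : Finset Eh
  /-- heat load edges; an edge in none of the three sets is a pipeline -/
  EhL : Finset Eh
  disjoint_pump_source : Disjoint Hh EhG
  disjoint_pump_load : Disjoint Hh EhL
  disjoint_source_load : Disjoint EhG EhL
  /-- constant heat loads -/
  hL : EhL → ℝ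
  /-- heat source time constants -/
  τh : EhG → ℝ
  τh_pos : ∀ e, 0 < τh e
  /-- heat source cost coefficients; the control gains are their inverses -/
  Qh : EhG → ℝ
  Qh_pos : ∀ e, 0 < Qh e
  /-- the heating network edge of the heat pump at a bus -/
  pumpEdge : He ≃ Hh
  /-- coefficients of performance of the heat pumps -/
  Co : He → ℝ
  Co_pos : ∀ j, 0 < Co j

namespace CHPNetwork

variable {Ne Nh Eh : Type*} [Fintype Ne] [DecidableEq Ne] [Fintype Nh] [DecidableEq Nh]
  [Fintype Eh] [DecidableEq Eh] (N : CHPNetwork Ne Nh Eh)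

/-- States `(η, ω, pG, T, hG)` with `T = col(T^E, T^N)`. -/
abbrev State : Type _ :=
  (N.Ee → ℝ) × (Ne → ℝ) × (N.NeG → ℝ) × (Eh ⊕ Nh → ℝ) × (N.EhG → ℝ)

variable {N}

/-- angle differences across the lines -/
def State.η (x : N.State) : N.Ee → ℝ := x.1
/-- bus frequencies -/
def State.ω (x : N.State) : Ne → ℝ := x.2.1
/-- generated electric powers -/
def State.pG (x : N.State) : N.NeG → ℝ := x.2.2.1
/-- edge and node temperatures -/
def State.T (x : N.State) : Eh ⊕ Nh → ℝ := x.2.2.2.1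
/-- heat powers of the conventional sources -/
def State.hG (x : N.State) : N.EhG → ℝ := x.2.2.2.2

variable (N)

/-- The volume-weighted average temperature. -/
def avgTemp (x : N.State) : ℝ := (∑ i, N.V i * x.T i) / ∑ i, N.V i

/-- Power transferred over a line. -/
def lineFlow (x : N.State) (e : N.Ee) : ℝ := N.B e * sin (x.η e)

/-- Power flowing into bus `j` over the lines, minus power flowing out of it. -/
def netInflow (x : N.State) (j : Ne) : ℝ :=
  (∑ e : N.Ee, if e.1.2 = j then N.lineFlow x e else 0)
    - ∑ e : N.Ee, if e.1.1 = j then N.lineFlow x e else 0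

/-- The swing equation at bus `j`; `pP` are the electric powers consumed by the heat pumps, `v` is
the time derivative of the state. -/
def Swing (x v : N.State) (pP : N.He → ℝ) (j : Ne) : Prop :=
  N.M j * v.ω j =
    -N.pL j - extendZero pP j + extendZero x.pG j - N.D j * x.ω j + N.netInflow x j

/-- Heat power delivered by the heat pumps: `Co j * pP j` at the edge of the pump at bus `j`. -/
def hP (pP : N.He → ℝ) : N.Hh → ℝ :=
  fun e => N.Co (N.pumpEdge.symm e) * pP (N.pumpEdge.symm e)

/-- The equations common to both heat pump modes. -/
structure CommonEqs (x v : N.State) (pP : N.He → ℝ) : Prop where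
  line : ∀ e : N.Ee, v.η e = x.ω e.1.1 - x.ω e.1.2
  generator : ∀ j : N.NeG, N.τe j * v.pG j = -x.pG j - 1 / N.Qe j * x.ω j
  heatEdge : ∀ e : Eh, N.V (.inl e) * v.T (.inl e) =
    N.q e * (x.T (.inr (N.src e)) - x.T (.inl e))
      + extendZero x.hG e + extendZero (N.hP pP) e - extendZero N.hL e
  heatNode : ∀ k : Nh, N.V (.inr k) * v.T (.inr k) =
    (∑ e, if N.tgt e = k then N.q e * x.T (.inl e) else 0)
      - (∑ e, if N.tgt e = k then N.q e else 0) * x.T (.inr k)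
  heatSource : ∀ e : N.EhG, N.τh e * v.hG e = -x.hG e - 1 / N.Qh e * N.avgTemp x

/-- Mode 1: every heat pump is a frequency dependent load, `pP j = a j * ω j`. -/
def Mode1 (a : N.He → ℝ) (x v : N.State) : Prop :=
  ∃ pP : N.He → ℝ, N.CommonEqs x v pP ∧ (∀ j, N.Swing x v pP j) ∧ ∀ j, pP j = a j * x.ω j

/-- Mode 2: every heat pump bus is a separate converter bus without inertia, load, generation or
damping, whose frequency is set to `m j` times the average temperature.  At these buses the power
balance takes the place of the swing equation (so `M`, `D`, `pL` are not used there). -/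
def Mode2 (m : N.He → ℝ) (x v : N.State) : Prop :=
  ∃ pP : N.He → ℝ, N.CommonEqs x v pP ∧ (∀ j ∉ N.He, N.Swing x v pP j) ∧
    ∀ j : N.He, 0 = -pP j + N.netInflow x j ∧ x.ω j = m j * N.avgTemp x

end CHPNetwork

section System

variable {X : Type*} [NormedAddCommGroup X] [NormedSpace ℝ X]

/-- `x` is a solution on `[0, ∞)` of the differential-algebraic system `F x x' = 0`, where the
relation `F x v` says that the equations hold at the state `x` with time derivative `v`. -/
def IsSolution (F : X → X → Prop) (x : ℝ → X) : Prop :=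
  ∃ v : ℝ → X, ∀ t, 0 ≤ t → HasDerivWithinAt x (v t) (Set.Ici 0) t ∧ F (x t) (v t)

/-- Equilibrium points: the equations hold with zero time derivative. -/
def IsEquilibrium (F : X → X → Prop) (x : X) : Prop := F x 0

/-- There is an open neighbourhood of `xs` such that from each of its points that is consistent with
the algebraic equations a solution on `[0, ∞)` starts, and all solutions starting in it converge to
an equilibrium point. -/
def LocallyConvergent (F : X → X → Prop) (xs : X) : Prop :=
  ∃ U : Set X, IsOpen U ∧ xs ∈ U ∧
    (∀ x₀ ∈ U, (∃ v, F x₀ v) → ∃ x, IsSolution F x ∧ x 0 = x₀) ∧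
    ∀ x, IsSolution F x → x 0 ∈ U → ∃ xe, IsEquilibrium F xe ∧ Tendsto x atTop (𝓝 xe)

end System

end

/-! After rescaling, both modes contain a network of sinusoidal springs, `η' = Γ u`, `μ u' = -Γᵀ (B
sin η) - d u - J u + c`, with `J` skew and `d ≥ 0` (`PassiveNetwork`). In mode 1, `u` collects the
frequencies and generator powers. In mode 2 the converter frequencies are `m j` times the average
temperature, so that temperature and the heat sources join `u`; the common ratio `κ = m j / Co j`
makes the heat the pumps deliver the exact transpose of the way the temperature drives the angles.

The Lyapunov function is the energy relative to a rest point: the Bregman distance of the potential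
`-B cos η` plus the kinetic term. Its derivative is minus the dissipation `∑ d (u - u₀)²`. Inside
`(-π/2, π/2)` the potential is strongly convex, so a low initial energy traps the angles. Barbalat's
lemma then makes the dissipation and all forces vanish in the limit; an undamped variable is
recovered from the vanishing force on a damped one. Rest points need not be isolated, so the angles
are handled separately: any cluster point is itself a rest point, the energy relative to it is
nonincreasing and comes arbitrarily close to `0`, hence the whole trajectory converges to it
(`IsRest.exists_nhds_tendsto`).

It remains to treat the heat. The mass flows conserve total heat, so the average temperature obeys a
scalar equation. In mode 1 with heat sources this is a stable linear system with convergent input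
(`exists_tendsto_storage`). Without sources it is a pure integrator of frequency deviations, and a
duality argument shows that their integrals converge (`exists_tendsto_antideriv`). Once the average
converges, diffusion along the connected network makes all temperatures converge
(`exists_tendsto_temperature`).

For existence, the algebraic equations give the remaining frequencies explicitly, and the reduced
vector field is `C¹` and globally Lipschitz because `sin` is. A limit of a solution is an
equilibrium because a convergent function whose derivative converges has derivative limit `0`. -/

open scoped NNReal Manifold ContDiff in
/-- A continuously differentiable, globally Lipschitz vector field has global integral curves. -/
theorem exists_forall_hasDerivAt_of_lipschitzWith {E : Type*} [NormedAddCommGroup E]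
    [NormedSpace ℝ E] [CompleteSpace E] {f : E → E} {K : ℝ≥0} (hK : LipschitzWith K f)
    (hf : ContDiff ℝ 1 f) (x₀ : E) :
    ∃ γ : ℝ → E, γ 0 = x₀ ∧ ∀ t, HasDerivAt γ (f (γ t)) t := by
  have hv : ContMDiff 𝓘(ℝ, E) 𝓘(ℝ, E).tangent 1
      (fun x ↦ (⟨x, f x⟩ : TangentBundle 𝓘(ℝ, E) E)) :=
    contMDiff_vectorSpace_iff_contDiff.2 hf
  have hε : (0 : ℝ) < 1 / (2 * (K + 1)) := by positivity
  have hloc (x : E) : ∃ γ : ℝ → E, γ 0 = x ∧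
      IsMIntegralCurveOn (I := 𝓘(ℝ, E)) γ f
        (Set.Ioo (-(1 / (2 * (K + 1)) : ℝ)) (1 / (2 * (K + 1)))) := by
    set ε : ℝ := 1 / (2 * (K + 1)) with hεd
    have hmem : (0 : ℝ) ∈ Set.Icc (-ε) ε := ⟨by linarith, hε.le⟩
    -- On the ball of radius `‖f x‖` around `x` the field is at most `(K + 1) ‖f x‖`. With the bound
    -- `2 (K + 1) ‖f x‖` the existence time is `1 / (2 (K + 1))`, independent of `x`, so local
    -- curves can be glued.
    have hPL : IsPicardLindelof (fun _ => f) (⟨0, hmem⟩ : Set.Icc (-ε) ε) x ‖f x‖₊ 0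
        ((K + 1) * (2 * ‖f x‖₊)) K := by
      refine IsPicardLindelof.of_time_independent (fun y hy => ?_) hK.lipschitzOnWith ?_
      · have h1 := hK.dist_le_mul y x
        rw [dist_eq_norm] at h1
        have h2 : ‖f y‖ ≤ ‖f x‖ + ‖f y - f x‖ := by
          simpa using norm_add_le (f x) (f y - f x)
        have h3 : dist y x ≤ ‖f x‖ := by simpa using hy
        push_cast
        have h4 : (K : ℝ) * dist y x ≤ K * ‖f x‖ := by gcongr
        nlinarith [norm_nonneg (f x), K.2, mul_nonneg K.2 (norm_nonneg (f x))]
      · simp only [sub_zero, zero_sub, neg_neg, max_self, NNReal.coe_zero]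
        push_cast
        simp only [hεd]
        field_simp
        exact le_rfl
    obtain ⟨α, hα0, hα⟩ := hPL.exists_eq_forall_mem_Icc_hasDerivWithinAt₀
    refine ⟨α, hα0, fun t ht => ?_⟩
    have h := (hα t (Set.Ioo_subset_Icc_self ht)).mono Set.Ioo_subset_Icc_self
    exact h.hasFDerivWithinAt.hasMFDerivWithinAt
  obtain ⟨γ, h0, hγ⟩ := exists_isMIntegralCurve_of_isMIntegralCurveOn (I := 𝓘(ℝ, E)) hv hε hloc x₀
  refine ⟨γ, h0, fun t => ?_⟩
  have h : HasFDerivAt γ ((1 : ℝ →L[ℝ] ℝ).smulRight (f (γ t))) t :=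
    hasMFDerivAt_iff_hasFDerivAt.1 (hγ t)
  have h' := h.hasDerivAt
  rwa [ContinuousLinearMap.smulRight_apply, one_apply_eq_self, one_smul] at h'

/-! ### Mean value and comparison arguments on `[0, ∞)` -/

theorem exists_slope_of_hasDerivWithinAt_Ici {g g' : ℝ → ℝ}
    (hg : ∀ t, 0 ≤ t → HasDerivWithinAt g (g' t) (Set.Ici 0) t) {s t : ℝ} (hs : 0 ≤ s)
    (hst : s < t) : ∃ ξ ∈ Set.Ioo s t, g t - g s = g' ξ * (t - s) := by
  obtain ⟨ξ, hξ, h⟩ := exists_hasDerivAt_eq_slope g g' hst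
    (fun r hr => ((hg r (hs.trans hr.1)).continuousWithinAt).mono
      (fun y hy => hs.trans hy.1))
    (fun r hr => (hg r (hs.trans hr.1.le)).hasDerivAt (Ici_mem_nhds (hs.trans_lt hr.1)))
  refine ⟨ξ, hξ, ?_⟩
  rw [h]
  field_simp [(sub_pos.2 hst).ne']

/-- If a convergent function has a Lipschitz derivative then the derivative tends to zero. -/
theorem tendsto_deriv_zero_of_lipschitz {g g' : ℝ → ℝ} {C l : ℝ}
    (hg : ∀ t, 0 ≤ t → HasDerivWithinAt g (g' t) (Set.Ici 0) t)
    (hL : ∀ s t, 0 ≤ s → 0 ≤ t → |g' t - g' s| ≤ C * |t - s|)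
    (hlim : Tendsto g atTop (𝓝 l)) : Tendsto g' atTop (𝓝 0) := by
  have hC : 0 ≤ C := by
    have := hL 0 1 le_rfl zero_le_one
    simp only [sub_zero, abs_one, mul_one] at this
    exact (abs_nonneg _).trans this
  rw [Metric.tendsto_atTop] at hlim ⊢
  intro ε hε
  -- Barbalat's lemma: on a window of length `h` the derivative varies by at most `ε / 2`, while `g`
  -- eventually changes by less than `ε h / 2`, so some value of the derivative in the window is
  -- below `ε / 2`.
  set h := ε / (2 * (C + 1)) with hh
  have hpos : 0 < h := by positivity
  obtain ⟨T, hT⟩ := hlim (ε * h / 4) (by positivity)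
  refine ⟨max T 0, fun t ht => ?_⟩
  have ht0 : 0 ≤ t := (le_max_right _ _).trans ht
  have htT : T ≤ t := (le_max_left _ _).trans ht
  obtain ⟨ξ, hξ, hs⟩ := exists_slope_of_hasDerivWithinAt_Ici hg ht0 (show t < t + h by linarith)
  have h1 := hT t htT
  have h2 := hT (t + h) (by linarith)
  rw [Real.dist_eq] at h1 h2 ⊢
  rw [sub_zero]
  have h3 := hL ξ t (ht0.trans hξ.1.le) ht0
  have h4 : |t - ξ| ≤ h := by
    rw [abs_le]; constructor <;> linarith [hξ.1, hξ.2]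
  have h5 : |g' ξ| * h < ε / 2 * h := by
    have : |g' ξ * (t + h - t)| = |g' ξ| * h := by
      rw [abs_mul, add_sub_cancel_left, abs_of_pos hpos]
    rw [← this, ← hs]
    have := abs_sub_lt_iff.1 h1
    have := abs_sub_lt_iff.1 h2
    rw [abs_lt]
    constructor <;> linarith
  have h6 : |g' ξ| < ε / 2 := lt_of_mul_lt_mul_right h5 hpos.le
  have h7 : C * |t - ξ| ≤ ε / 2 := by
    calc C * |t - ξ| ≤ (C + 1) * h := by gcongr; linarith
      _ = ε / 2 := by rw [hh]; field_simp
  calc |g' t| = |g' ξ + (g' t - g' ξ)| := by ring_nf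
    _ ≤ |g' ξ| + |g' t - g' ξ| := abs_add_le _ _
    _ < ε := by linarith

/-- If a function and its derivative both converge then the derivative tends to zero. -/
theorem eq_zero_of_tendsto_of_tendsto_deriv {g g' : ℝ → ℝ} {l m : ℝ}
    (hg : ∀ t, 0 ≤ t → HasDerivWithinAt g (g' t) (Set.Ici 0) t)
    (hlim : Tendsto g atTop (𝓝 l)) (hlim' : Tendsto g' atTop (𝓝 m)) : m = 0 := by
  have h : ∀ t : ℝ, ∃ ξ, t ≤ ξ ∧ (0 ≤ t → g (t + 1) - g t = g' ξ) := by
    intro t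
    by_cases ht : 0 ≤ t
    · obtain ⟨ξ, hξ, h⟩ := exists_slope_of_hasDerivWithinAt_Ici hg ht (show t < t + 1 by linarith)
      exact ⟨ξ, hξ.1.le, fun _ => by rw [h]; ring⟩
    · exact ⟨t, le_rfl, fun h => absurd h ht⟩
  choose ξ hξ hs using h
  have h1 : Tendsto (fun t => g' (ξ t)) atTop (𝓝 m) :=
    hlim'.comp (tendsto_atTop_mono hξ tendsto_id)
  have h2 : Tendsto (fun t => g (t + 1) - g t) atTop (𝓝 (l - l)) :=
    (hlim.comp (tendsto_atTop_add_const_right _ 1 tendsto_id)).sub hlim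
  rw [sub_self] at h2
  refine tendsto_nhds_unique (h1.congr' ?_) h2
  filter_upwards [eventually_ge_atTop 0] with t ht using (hs t ht).symm

theorem antitoneOn_Ici_of_hasDerivWithinAt_nonpos {g g' : ℝ → ℝ} {T : ℝ} (hT : 0 ≤ T)
    (hg : ∀ t, 0 ≤ t → HasDerivWithinAt g (g' t) (Set.Ici 0) t) (h : ∀ t, T ≤ t → g' t ≤ 0) :
    AntitoneOn g (Set.Ici T) := by
  intro s hs t ht hst
  rcases hst.eq_or_lt with rfl | hlt
  · exact le_rfl
  · obtain ⟨ξ, hξ, hs'⟩ := exists_slope_of_hasDerivWithinAt_Ici hg (hT.trans hs) hlt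
    have h1 := h ξ (le_trans hs hξ.1.le)
    have : g' ξ * (t - s) ≤ 0 := mul_nonpos_of_nonpos_of_nonneg h1 (by linarith)
    linarith

/-- A nonnegative solution of `y' ≤ -α y + β` with `β → 0` tends to zero. -/
theorem tendsto_zero_of_deriv_le {y y' β : ℝ → ℝ} {α : ℝ} (hα : 0 < α)
    (hy : ∀ t, 0 ≤ t → HasDerivWithinAt y (y' t) (Set.Ici 0) t) (hy0 : ∀ t, 0 ≤ y t)
    (hle : ∀ t, 0 ≤ t → y' t ≤ -α * y t + β t) (hβ : Tendsto β atTop (𝓝 0)) :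
    Tendsto y atTop (𝓝 0) := by
  rw [Metric.tendsto_atTop]
  intro ε hε
  obtain ⟨T, hT0, hT⟩ : ∃ T, 0 ≤ T ∧ ∀ t, T ≤ t → β t ≤ α * (ε / 2) := by
    have := hβ.eventually (Iic_mem_nhds (show 0 < α * (ε / 2) by positivity))
    obtain ⟨T, hT⟩ := eventually_atTop.1 this
    exact ⟨max T 0, le_max_right _ _, fun t ht => hT t ((le_max_left _ _).trans ht)⟩
  -- Once `β ≤ α ε / 2`, the excess of `y` over `ε / 2` decays at rate `α`.
  have hanti : AntitoneOn (fun t => (y t - ε / 2) * exp (α * t)) (Set.Ici T) := by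
    refine antitoneOn_Ici_of_hasDerivWithinAt_nonpos hT0
      (g' := fun t => y' t * exp (α * t) + (y t - ε / 2) * (exp (α * t) * α)) (fun t ht => ?_)
      fun t ht => ?_
    · have he : HasDerivAt (fun t => exp (α * t)) (exp (α * t) * α) t := by
        simpa using ((hasDerivAt_id t).const_mul α).exp
      exact ((hy t ht).sub_const _).mul he.hasDerivWithinAt
    · have h1 := hle t (hT0.trans ht)
      have h2 := hT t ht
      have : y' t * exp (α * t) + (y t - ε / 2) * (exp (α * t) * α)
        = (y' t + α * (y t - ε / 2)) * exp (α * t) := by ring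
      rw [this]
      exact mul_nonpos_of_nonpos_of_nonneg (by linarith) (exp_pos _).le
  have hlim : Tendsto (fun t => (y T - ε / 2) * exp (α * T) * exp (-(α * t))) atTop (𝓝 0) := by
    have := (tendsto_exp_neg_atTop_nhds_zero.comp (tendsto_id.const_mul_atTop hα)).const_mul
      ((y T - ε / 2) * exp (α * T))
    simpa using this
  obtain ⟨T', hT'⟩ := eventually_atTop.1 (hlim.eventually (Iio_mem_nhds (half_pos hε)))
  refine ⟨max T T', fun t ht => ?_⟩
  have htT : T ≤ t := (le_max_left _ _).trans ht
  have h1 := hanti (Set.mem_Ici.2 le_rfl) (Set.mem_Ici.2 htT) htT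
  have h2 := hT' t ((le_max_right _ _).trans ht)
  simp only at h1 h2
  have h3 : y t - ε / 2 ≤ (y T - ε / 2) * exp (α * T) * exp (-(α * t)) := by
    have := mul_le_mul_of_nonneg_right h1 (exp_pos (-(α * t))).le
    rwa [mul_assoc (y t - ε / 2), ← exp_add, add_neg_cancel, exp_zero, mul_one] at this
  rw [Real.dist_eq, sub_zero, abs_of_nonneg (hy0 t)]
  linarith

/-! ### Linear systems with a quadratic Lyapunov function -/

/-- Strict lower quadratic bound for a positive continuous 2-homogeneous function. -/
theorem exists_pos_mul_sq_norm_le {Z : Type*} [NormedAddCommGroup Z] [NormedSpace ℝ Z]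
    [FiniteDimensional ℝ Z] {Q : Z → ℝ} (hQ : Continuous Q)
    (hhom : ∀ (r : ℝ) z, Q (r • z) = r ^ 2 * Q z) (hpos : ∀ z, z ≠ 0 → 0 < Q z) :
    ∃ c > 0, ∀ z, c * ‖z‖ ^ 2 ≤ Q z := by
  have hc : IsCompact (Metric.sphere (0 : Z) 1) := by
    have := FiniteDimensional.proper_real Z
    exact isCompact_sphere _ _
  have h0 : Q 0 = 0 := by simpa using hhom 0 0
  -- The sphere is empty precisely when the space is trivial.
  rcases (Metric.sphere (0 : Z) 1).eq_empty_or_nonempty with he | hne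
  · refine ⟨1, one_pos, fun z => ?_⟩
    by_cases hz : z = 0
    · simp [hz, h0]
    · have : (‖z‖⁻¹ • z) ∈ Metric.sphere (0 : Z) 1 := by
        simp [norm_smul, norm_ne_zero_iff.2 hz]
      rw [he] at this
      exact absurd this (Set.notMem_empty _)
  · obtain ⟨z₀, hz₀, hmin⟩ := hc.exists_isMinOn hne hQ.continuousOn
    have hz₀' : z₀ ≠ 0 := by
      rintro rfl
      simp at hz₀
    refine ⟨Q z₀, hpos _ hz₀', fun z => ?_⟩
    by_cases hz : z = 0
    · simp [hz, h0]
    · have hm : (‖z‖⁻¹ • z) ∈ Metric.sphere (0 : Z) 1 := by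
        simp [norm_smul, norm_ne_zero_iff.2 hz]
      have h1 : Q z₀ ≤ Q (‖z‖⁻¹ • z) := hmin hm
      have hn : 0 < ‖z‖ := norm_pos_iff.2 hz
      have h2 : Q z = ‖z‖ ^ 2 * Q (‖z‖⁻¹ • z) := by
        rw [← hhom, smul_smul, mul_inv_cancel₀ hn.ne', one_smul]
      rw [h2, mul_comm]
      gcongr

/-- Converging input, converging state: a linear system with a strict quadratic Lyapunov function
converges whenever its input does. -/
theorem exists_tendsto_of_hasDerivWithinAt_linear {Z : Type*} [NormedAddCommGroup Z]
    [NormedSpace ℝ Z] [FiniteDimensional ℝ Z] {A : Z →L[ℝ] Z} {B : Z →L[ℝ] Z →L[ℝ] ℝ}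
    (hsymm : ∀ y z, B y z = B z y) (hpos : ∀ z, z ≠ 0 → 0 < B z z)
    (hneg : ∀ z, z ≠ 0 → B z (A z) < 0) {z b : ℝ → Z} {b₀ : Z}
    (hz : ∀ t, 0 ≤ t → HasDerivWithinAt z (A (z t) + b t) (Set.Ici 0) t)
    (hb : Tendsto b atTop (𝓝 b₀)) : ∃ z₀, Tendsto z atTop (𝓝 z₀) := by
  -- Strict dissipation excludes a kernel, so in finite dimension the limiting input `b₀` has an
  -- equilibrium `z₀`, the candidate limit.
  have hinj : Function.Injective (A : Z →ₗ[ℝ] Z) := by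
    rw [← LinearMap.ker_eq_bot, LinearMap.ker_eq_bot']
    intro y hy
    by_contra hne
    have := hneg y hne
    have h0 : A y = 0 := hy
    simp [h0] at this
  obtain ⟨z₀, hz₀⟩ := (LinearMap.injective_iff_surjective.1 hinj) (-b₀)
  have hz₀ : A z₀ = -b₀ := hz₀
  refine ⟨z₀, ?_⟩
  obtain ⟨c, hc, hcle⟩ := exists_pos_mul_sq_norm_le (Q := fun z => B z z) (by fun_prop)
    (fun r z => by simp; ring) hpos
  obtain ⟨α, hα, hαle⟩ := exists_pos_mul_sq_norm_le (Q := fun z => -B z (A z)) (by fun_prop)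
    (fun r z => by simp; ring) (fun z hz => by simpa using hneg z hz)
  set C := ‖B‖ + 1 with hC
  have hCpos : 0 < C := by positivity
  have hBle : ∀ y z, B y z ≤ C * ‖y‖ * ‖z‖ := fun y z =>
    calc B y z ≤ ‖B y z‖ := le_abs_self _
      _ ≤ ‖B‖ * ‖y‖ * ‖z‖ := B.le_opNorm₂ y z
      _ ≤ C * ‖y‖ * ‖z‖ := by gcongr; linarith
  set w : ℝ → Z := fun t => z t - z₀ with hw
  have hwd : ∀ t, 0 ≤ t → HasDerivWithinAt w (A (w t) + (b t - b₀)) (Set.Ici 0) t := by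
    intro t ht
    have h := (hz t ht).sub_const z₀
    have e : A (z t) + b t = A (w t) + (b t - b₀) := by
      simp only [hw, map_sub, hz₀]; abel
    rwa [e] at h
  have hy : Tendsto (fun t => B (w t) (w t)) atTop (𝓝 0) := by
    refine tendsto_zero_of_deriv_le (α := α / C) (by positivity)
      (y' := fun t => 2 * B (w t) (A (w t) + (b t - b₀)))
      (β := fun t => C ^ 2 / α * ‖b t - b₀‖ ^ 2) (fun t ht => ?_) (fun t => ?_) (fun t ht => ?_) ?_
    · have h1 : HasDerivWithinAt (fun t => B (w t)) (B (A (w t) + (b t - b₀))) (Set.Ici 0) t :=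
        B.hasFDerivAt.comp_hasDerivWithinAt t (hwd t ht)
      have h2 := h1.clm_apply (hwd t ht)
      rwa [hsymm (A (w t) + (b t - b₀)) (w t), ← two_mul] at h2
    · exact le_trans (by positivity) (hcle (w t))
    · rw [map_add]
      have h1 := hαle (w t)
      have h2 := hBle (w t) (b t - b₀)
      have h3 := hBle (w t) (w t)
      -- Young's inequality: the input costs half of the dissipation `2 α ‖w‖²`; the other half
      -- dominates `α / C` times the Lyapunov function.
      have h4 : 2 * (C * ‖w t‖ * ‖b t - b₀‖) ≤ α * ‖w t‖ ^ 2 + C ^ 2 / α * ‖b t - b₀‖ ^ 2 := by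
        have : 0 ≤ (α * ‖w t‖ - C * ‖b t - b₀‖) ^ 2 / α := by positivity
        have e : (α * ‖w t‖ - C * ‖b t - b₀‖) ^ 2 / α = α * ‖w t‖ ^ 2
            - 2 * (C * ‖w t‖ * ‖b t - b₀‖) + C ^ 2 / α * ‖b t - b₀‖ ^ 2 := by
          field_simp
          ring
        linarith
      have h5 : α / C * B (w t) (w t) ≤ α * ‖w t‖ ^ 2 := by
        calc α / C * B (w t) (w t) ≤ α / C * (C * ‖w t‖ * ‖w t‖) := by gcongr
          _ = α * ‖w t‖ ^ 2 := by field_simp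
      linarith
    · have h1 : Tendsto (fun t => ‖b t - b₀‖) atTop (𝓝 0) := by
        simpa using (hb.sub_const b₀).norm
      simpa using (h1.pow 2).const_mul (C ^ 2 / α)
  have hsq : Tendsto (fun t => ‖w t‖ ^ 2) atTop (𝓝 0) := by
    refine squeeze_zero (fun t => by positivity) (fun t => ?_)
      (by simpa using hy.const_mul c⁻¹)
    rw [inv_mul_eq_div, le_div_iff₀ hc]
    linarith [hcle (w t)]
  have hn : Tendsto (fun t => ‖w t‖) atTop (𝓝 0) := by
    have := hsq.sqrt
    simpa [Real.sqrt_sq] using this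
  exact tendsto_sub_nhds_zero_iff.1 (tendsto_zero_iff_norm_tendsto_zero.2 hn)

/-! ### Strong convexity of the line potential -/

/-- Between `r` and `s` the second derivative `cos` of the potential `-cos` is at least `sin ρ`. Two
applications of the mean value theorem replace the double integration: the first bounds the growth
of `sin`, the second that of the potential. -/
theorem mul_sq_le_cos_potential_of_lt {ρ r s : ℝ} (hr : |r| ≤ π / 2 - ρ) (hs : |s| ≤ π / 2 - ρ)
    (hρ : 0 < ρ) (hrs : r < s) :
    sin ρ / 2 * (s - r) ^ 2 ≤ cos r - cos s - (s - r) * sin r := by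
  have hr' := abs_le.1 hr
  have hs' := abs_le.1 hs
  have key : ∀ x ∈ Set.Icc r s, sin ρ * (x - r) ≤ sin x - sin r := by
    intro x hx
    rcases hx.1.eq_or_lt with rfl | hlt
    · simp
    · obtain ⟨ζ, hζ, h⟩ := exists_hasDerivAt_eq_slope sin cos hlt continuous_sin.continuousOn
        (fun y _ => hasDerivAt_sin y)
      have h1 : sin ρ ≤ cos ζ := by
        rw [← cos_pi_div_two_sub, ← cos_abs ζ]
        refine cos_le_cos_of_nonneg_of_le_pi (abs_nonneg _) (by linarith [pi_pos]) ?_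
        rw [abs_le]
        constructor <;> linarith [hζ.1, hζ.2, hx.2]
      rw [h, le_div_iff₀ (sub_pos.2 hlt)] at h1
      exact h1
  obtain ⟨ξ, hξ, h⟩ := exists_hasDerivAt_eq_slope
    (fun x => cos r - cos x - (x - r) * sin r - sin ρ / 2 * (x - r) ^ 2)
    (fun x => sin x - sin r - sin ρ * (x - r)) hrs (by fun_prop) (fun x _ => by
      have h1 := ((hasDerivAt_cos x).const_sub (cos r)).sub
        (((hasDerivAt_id x).sub_const r).mul_const (sin r))
      have h2 := h1.sub ((((hasDerivAt_id x).sub_const r).pow 2).const_mul (sin ρ / 2))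
      refine h2.congr_deriv ?_
      simp
      ring)
  have h1 := key ξ ⟨hξ.1.le, hξ.2.le⟩
  rw [eq_div_iff (sub_pos.2 hrs).ne'] at h
  have h2 : 0 ≤ (sin ξ - sin r - sin ρ * (ξ - r)) * (s - r) :=
    mul_nonneg (by linarith) (by linarith)
  rw [h] at h2
  simp only [sub_self, zero_mul, ne_eq, OfNat.ofNat_ne_zero, not_false_eq_true, zero_pow,
    mul_zero, sub_zero] at h2
  linarith

/-- The potential energy of a line is strongly convex away from `±π/2`. -/
theorem mul_sq_le_cos_potential {ρ r s : ℝ} (hr : |r| ≤ π / 2 - ρ) (hs : |s| ≤ π / 2 - ρ)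
    (hρ : 0 < ρ) : sin ρ / 2 * (s - r) ^ 2 ≤ cos r - cos s - (s - r) * sin r := by
  rcases lt_trichotomy r s with h | rfl | h
  · exact mul_sq_le_cos_potential_of_lt hr hs hρ h
  · simp
  · have := mul_sq_le_cos_potential_of_lt (r := -r) (s := -s) (by rwa [abs_neg])
      (by rwa [abs_neg]) hρ (by linarith)
    rw [cos_neg, cos_neg, sin_neg] at this
    nlinarith

/-! ### Bounded and Lipschitz functions on `[0, ∞)` -/

/-- Boundedness on `[0, ∞)`. -/
def BddOnPos (g : ℝ → ℝ) : Prop := ∃ C, ∀ t, 0 ≤ t → |g t| ≤ C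

/-- Lipschitz continuity on `[0, ∞)`. -/
def LipOnPos (g : ℝ → ℝ) : Prop := ∃ C, ∀ s t, 0 ≤ s → 0 ≤ t → |g t - g s| ≤ C * |t - s|

namespace BddOnPos

variable {g h : ℝ → ℝ}

theorem const (c : ℝ) : BddOnPos fun _ => c := ⟨|c|, fun _ _ => le_rfl⟩

theorem add (hg : BddOnPos g) (hh : BddOnPos h) : BddOnPos fun t => g t + h t := by
  obtain ⟨C, hC⟩ := hg
  obtain ⟨D, hD⟩ := hh
  exact ⟨C + D, fun t ht => (abs_add_le _ _).trans (add_le_add (hC t ht) (hD t ht))⟩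

theorem mul (hg : BddOnPos g) (hh : BddOnPos h) : BddOnPos fun t => g t * h t := by
  obtain ⟨C, hC⟩ := hg
  obtain ⟨D, hD⟩ := hh
  refine ⟨C * D, fun t ht => ?_⟩
  rw [abs_mul]
  exact mul_le_mul (hC t ht) (hD t ht) (abs_nonneg _) ((abs_nonneg _).trans (hC t ht))

theorem const_mul (c : ℝ) (hg : BddOnPos g) : BddOnPos fun t => c * g t := (const c).mul hg

theorem sub (hg : BddOnPos g) (hh : BddOnPos h) : BddOnPos fun t => g t - h t := by
  simpa [sub_eq_add_neg] using hg.add (hh.const_mul (-1))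

theorem sum {ι : Type*} (s : Finset ι) {g : ι → ℝ → ℝ} (hg : ∀ i, BddOnPos (g i)) :
    BddOnPos fun t => ∑ i ∈ s, g i t := by
  classical
  induction s using Finset.induction_on with
  | empty => simpa using const 0
  | insert a s ha ih => simpa [Finset.sum_insert ha] using (hg a).add ih

theorem sin (g : ℝ → ℝ) : BddOnPos fun t => Real.sin (g t) := ⟨1, fun _ _ => abs_sin_le_one _⟩

end BddOnPos

namespace LipOnPos

variable {g h : ℝ → ℝ}

theorem const (c : ℝ) : LipOnPos fun _ => c := ⟨0, fun _ _ _ _ => by simp⟩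

theorem add (hg : LipOnPos g) (hh : LipOnPos h) : LipOnPos fun t => g t + h t := by
  obtain ⟨C, hC⟩ := hg
  obtain ⟨D, hD⟩ := hh
  refine ⟨C + D, fun s t hs ht => ?_⟩
  rw [add_sub_add_comm, add_mul]
  exact (abs_add_le _ _).trans (add_le_add (hC s t hs ht) (hD s t hs ht))

theorem const_mul (c : ℝ) (hg : LipOnPos g) : LipOnPos fun t => c * g t := by
  obtain ⟨C, hC⟩ := hg
  refine ⟨|c| * C, fun s t hs ht => ?_⟩
  rw [← mul_sub, abs_mul, mul_assoc]
  exact mul_le_mul_of_nonneg_left (hC s t hs ht) (abs_nonneg _)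

theorem sub (hg : LipOnPos g) (hh : LipOnPos h) : LipOnPos fun t => g t - h t := by
  simpa [sub_eq_add_neg] using hg.add (hh.const_mul (-1))

theorem sum {ι : Type*} (s : Finset ι) {g : ι → ℝ → ℝ} (hg : ∀ i, LipOnPos (g i)) :
    LipOnPos fun t => ∑ i ∈ s, g i t := by
  classical
  induction s using Finset.induction_on with
  | empty => simpa using const 0
  | insert a s ha ih => simpa [Finset.sum_insert ha] using (hg a).add ih

theorem sin (hg : LipOnPos g) : LipOnPos fun t => Real.sin (g t) := by
  obtain ⟨C, hC⟩ := hg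
  refine ⟨C, fun s t hs ht => le_trans ?_ (hC s t hs ht)⟩
  have := Real.lipschitzWith_sin.dist_le_mul (g t) (g s)
  simpa [Real.dist_eq] using this

theorem sq (hg : LipOnPos g) (hb : BddOnPos g) : LipOnPos fun t => g t ^ 2 := by
  obtain ⟨C, hC⟩ := hg
  obtain ⟨D, hD⟩ := hb
  refine ⟨2 * D * C, fun s t hs ht => ?_⟩
  rw [sq_sub_sq, abs_mul, mul_assoc]
  refine mul_le_mul ?_ (hC s t hs ht) (abs_nonneg _) ?_
  · refine (abs_add_le _ _).trans ?_
    linarith [hD s hs, hD t ht]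
  · linarith [hD s hs, abs_nonneg (g s)]

theorem of_deriv {g' : ℝ → ℝ} (hg : ∀ t, 0 ≤ t → HasDerivWithinAt g (g' t) (Set.Ici 0) t)
    (hb : BddOnPos g') : LipOnPos g := by
  obtain ⟨C, hC⟩ := hb
  have key : ∀ s t, 0 ≤ s → s < t → |g t - g s| ≤ C * |t - s| := by
    intro s t hs hst
    obtain ⟨ξ, hξ, h⟩ := exists_slope_of_hasDerivWithinAt_Ici hg hs hst
    rw [h, abs_mul]
    exact mul_le_mul_of_nonneg_right (hC ξ (hs.trans hξ.1.le)) (abs_nonneg _)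
  refine ⟨C, fun s t hs ht => ?_⟩
  rcases lt_trichotomy s t with h | rfl | h
  · exact key s t hs h
  · simp
  · rw [abs_sub_comm, abs_sub_comm t]
    exact key t s ht h

theorem tendsto_deriv {g' : ℝ → ℝ} {l : ℝ} (hL : LipOnPos g')
    (hg : ∀ t, 0 ≤ t → HasDerivWithinAt g (g' t) (Set.Ici 0) t)
    (hlim : Tendsto g atTop (𝓝 l)) : Tendsto g' atTop (𝓝 0) := by
  obtain ⟨C, hC⟩ := hL
  exact tendsto_deriv_zero_of_lipschitz hg hC hlim

end LipOnPos

/-! ### Passive networks: energy, trapping and convergence -/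

/-- A network of sinusoidal springs with angles `η` coupled to passive variables `u`:
`η' = Γ u` and `μ u' = -Γᵀ (B sin η) - d u - J u + c` with `J` skew-symmetric. Undamped variables
are detected through a damped one which is not attached to any spring. -/
structure PassiveNetwork (E K : Type*) [Fintype E] [Fintype K] where
  B : E → ℝ
  B_pos : ∀ e, 0 < B e
  Γ : E → K → ℝ
  μ : K → ℝ
  μ_nonneg : ∀ k, 0 ≤ μ k
  d : K → ℝ
  d_nonneg : ∀ k, 0 ≤ d k
  J : K → K → ℝ
  J_skew : ∀ k l, J k l = -J l k
  c : K → ℝ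
  d_pos : ∀ k, μ k = 0 → 0 < d k
  J_eq_zero : ∀ k l, μ k = 0 → μ l = 0 → J k l = 0
  detect : ∀ k, d k = 0 → ∃ l, (∀ e, Γ e l = 0) ∧ 0 < d l ∧ J l k ≠ 0 ∧
    ∀ k', k' ≠ k → d k' = 0 → J l k' = 0

namespace PassiveNetwork

variable {E K : Type*} [Fintype E] [Fintype K] (P : PassiveNetwork E K)

/-- The force acting on the variable `k`. -/
noncomputable def force (η : E → ℝ) (u : K → ℝ) (k : K) : ℝ :=
  -(∑ e, P.Γ e k * (P.B e * sin (η e))) - P.d k * u k - ∑ l, P.J k l * u l + P.c k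

/-- `(η, u)` solves the equations of the network on `[0, ∞)`. -/
structure IsTrajectory (η : ℝ → E → ℝ) (u u' : ℝ → K → ℝ) : Prop where
  hasDeriv_angle : ∀ e t, 0 ≤ t →
    HasDerivWithinAt (fun t => η t e) (∑ k, P.Γ e k * u t k) (Set.Ici 0) t
  hasDeriv : ∀ k t, 0 ≤ t → HasDerivWithinAt (fun t => u t k) (u' t k) (Set.Ici 0) t
  force_eq : ∀ k t, 0 ≤ t → P.μ k * u' t k = P.force (η t) (u t) k

/-- `(η₀, u₀)` is a rest point. -/
structure IsRest (η₀ : E → ℝ) (u₀ : K → ℝ) : Prop where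
  angle : ∀ e, ∑ k, P.Γ e k * u₀ k = 0
  force_eq : ∀ k, P.force η₀ u₀ k = 0

/-- The energy relative to a rest point. -/
noncomputable def energy (η₀ : E → ℝ) (u₀ : K → ℝ) (η : E → ℝ) (u : K → ℝ) : ℝ :=
  (∑ e, P.B e * (cos (η₀ e) - cos (η e) - (η e - η₀ e) * sin (η₀ e)))
    + ∑ k, P.μ k / 2 * (u k - u₀ k) ^ 2

variable {P} {η₀ : E → ℝ} {u₀ : K → ℝ} {η : ℝ → E → ℝ} {u u' : ℝ → K → ℝ}

theorem sum_skew_eq_zero (w : K → ℝ) : ∑ k, w k * ∑ l, P.J k l * w l = 0 := by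
  have h : ∑ k, w k * ∑ l, P.J k l * w l = -∑ k, w k * ∑ l, P.J k l * w l := by
    conv_lhs => simp only [Finset.mul_sum]
    rw [Finset.sum_comm]
    simp only [Finset.mul_sum]
    rw [← Finset.sum_neg_distrib]
    refine Finset.sum_congr rfl fun l _ => ?_
    rw [← Finset.sum_neg_distrib]
    refine Finset.sum_congr rfl fun k _ => ?_
    rw [P.J_skew k l]
    ring
  linarith

theorem IsRest.force_sub (h : P.IsRest η₀ u₀) (η : E → ℝ) (u : K → ℝ) (k : K) :
    P.force η u k = -(∑ e, P.Γ e k * (P.B e * (sin (η e) - sin (η₀ e))))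
      - P.d k * (u k - u₀ k) - ∑ l, P.J k l * (u l - u₀ l) := by
  have h0 := h.force_eq k
  have h1 : P.force η u k = P.force η u k - P.force η₀ u₀ k := by rw [h0, sub_zero]
  rw [h1]
  simp only [force, mul_sub, Finset.sum_sub_distrib]
  ring

/-- The spring power in the potential part cancels that in the kinetic part, because `Γ` enters once
directly and once transposed; `J` does no work by skew-symmetry. Only the damping is left. -/
theorem hasDeriv_energy (ht : P.IsTrajectory η u u') (h : P.IsRest η₀ u₀) {t : ℝ} (h0 : 0 ≤ t) :
    HasDerivWithinAt (fun t => P.energy η₀ u₀ (η t) (u t))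
      (-∑ k, P.d k * (u t k - u₀ k) ^ 2) (Set.Ici 0) t := by
  have h1 : HasDerivWithinAt
      (fun t => ∑ e, P.B e * (cos (η₀ e) - cos (η t e) - (η t e - η₀ e) * sin (η₀ e)))
      (∑ e, P.B e * (sin (η t e) - sin (η₀ e)) * ∑ k, P.Γ e k * u t k) (Set.Ici 0) t := by
    refine HasDerivWithinAt.fun_sum fun e _ => ?_
    have hd := ht.hasDeriv_angle e t h0
    have := ((hd.cos.const_sub (cos (η₀ e))).sub
      ((hd.sub_const (η₀ e)).mul_const (sin (η₀ e)))).const_mul (P.B e)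
    refine this.congr_deriv ?_
    ring
  have h2 : HasDerivWithinAt (fun t => ∑ k, P.μ k / 2 * (u t k - u₀ k) ^ 2)
      (∑ k, (u t k - u₀ k) * (P.μ k * u' t k)) (Set.Ici 0) t := by
    refine HasDerivWithinAt.fun_sum fun k _ => ?_
    have := (((ht.hasDeriv k t h0).sub_const (u₀ k)).pow 2).const_mul (P.μ k / 2)
    refine this.congr_deriv ?_
    simp
    ring
  refine (h1.add h2).congr_deriv ?_
  have h3 : ∀ e, ∑ k, P.Γ e k * u t k = ∑ k, P.Γ e k * (u t k - u₀ k) := by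
    intro e
    simp only [mul_sub, Finset.sum_sub_distrib, h.angle e, sub_zero]
  have h4 : ∑ e, P.B e * (sin (η t e) - sin (η₀ e)) * ∑ k, P.Γ e k * u t k
      = ∑ k, (u t k - u₀ k) * ∑ e, P.Γ e k * (P.B e * (sin (η t e) - sin (η₀ e))) := by
    simp only [h3, Finset.mul_sum]
    rw [Finset.sum_comm]
    exact Finset.sum_congr rfl fun k _ => Finset.sum_congr rfl fun e _ => by ring
  have h5 := P.sum_skew_eq_zero (fun k => u t k - u₀ k)
  have h6 : ∑ k, (u t k - u₀ k) * (P.μ k * u' t k)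
      = -(∑ k, (u t k - u₀ k) * ∑ e, P.Γ e k * (P.B e * (sin (η t e) - sin (η₀ e))))
        - (∑ k, P.d k * (u t k - u₀ k) ^ 2)
        - ∑ k, (u t k - u₀ k) * ∑ l, P.J k l * (u t l - u₀ l) := by
    rw [← Finset.sum_neg_distrib, ← Finset.sum_sub_distrib, ← Finset.sum_sub_distrib]
    refine Finset.sum_congr rfl fun k _ => ?_
    rw [ht.force_eq k t h0, h.force_sub]
    ring
  rw [h4, h6, h5]
  ring

theorem energy_antitone (ht : P.IsTrajectory η u u') (h : P.IsRest η₀ u₀) :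
    AntitoneOn (fun t => P.energy η₀ u₀ (η t) (u t)) (Set.Ici 0) := by
  refine antitoneOn_Ici_of_hasDerivWithinAt_nonpos le_rfl (fun t h0 => hasDeriv_energy ht h h0)
    fun t _ => ?_
  exact neg_nonpos.2 (Finset.sum_nonneg fun k _ => mul_nonneg (P.d_nonneg k) (sq_nonneg _))

theorem potential_nonneg {ρ : ℝ} (hρ : 0 < ρ) (hsin : 0 ≤ sin ρ) {θ θ' : E → ℝ}
    (h : ∀ e, |θ e| ≤ π / 2 - ρ) (h' : ∀ e, |θ' e| ≤ π / 2 - ρ) (e : E) :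
    0 ≤ P.B e * (cos (θ e) - cos (θ' e) - (θ' e - θ e) * sin (θ e)) :=
  mul_nonneg (P.B_pos e).le ((by positivity : (0 : ℝ) ≤ sin ρ / 2 * (θ' e - θ e) ^ 2).trans
    (mul_sq_le_cos_potential (h e) (h' e) hρ))

theorem kinetic_nonneg (w w₀ : K → ℝ) (k : K) : 0 ≤ P.μ k / 2 * (w k - w₀ k) ^ 2 :=
  mul_nonneg (div_nonneg (P.μ_nonneg k) zero_le_two) (sq_nonneg _)

theorem mul_sq_angle_le_energy {ρ : ℝ} (hρ : 0 < ρ) (hsin : 0 ≤ sin ρ) {θ θ' : E → ℝ}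
    (h : ∀ e, |θ e| ≤ π / 2 - ρ) (h' : ∀ e, |θ' e| ≤ π / 2 - ρ) (w w₀ : K → ℝ) (e : E) :
    P.B e * (sin ρ / 2 * (θ' e - θ e) ^ 2) ≤ P.energy θ w₀ θ' w := by
  have h1 := Finset.single_le_sum
    (f := fun e => P.B e * (cos (θ e) - cos (θ' e) - (θ' e - θ e) * sin (θ e)))
    (fun e _ => potential_nonneg hρ hsin h h' e) (Finset.mem_univ e)
  have h2 : 0 ≤ ∑ k, P.μ k / 2 * (w k - w₀ k) ^ 2 :=
    Finset.sum_nonneg fun k _ => kinetic_nonneg w w₀ k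
  have h3 := mul_le_mul_of_nonneg_left (mul_sq_le_cos_potential (h e) (h' e) hρ) (P.B_pos e).le
  simp only [energy] at h1 ⊢
  linarith

theorem kinetic_le_energy {ρ : ℝ} (hρ : 0 < ρ) (hsin : 0 ≤ sin ρ) {θ θ' : E → ℝ}
    (h : ∀ e, |θ e| ≤ π / 2 - ρ) (h' : ∀ e, |θ' e| ≤ π / 2 - ρ) (w w₀ : K → ℝ) (k : K) :
    P.μ k / 2 * (w k - w₀ k) ^ 2 ≤ P.energy θ w₀ θ' w := by
  have h1 := Finset.single_le_sum (f := fun k => P.μ k / 2 * (w k - w₀ k) ^ 2)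
    (fun k _ => kinetic_nonneg w w₀ k) (Finset.mem_univ k)
  have h2 : 0 ≤ ∑ e, P.B e * (cos (θ e) - cos (θ' e) - (θ' e - θ e) * sin (θ e)) :=
    Finset.sum_nonneg fun e _ => potential_nonneg hρ hsin h h' e
  simp only [energy] at h1 ⊢
  linarith

theorem energy_nonneg {ρ : ℝ} (hρ : 0 < ρ) (hsin : 0 ≤ sin ρ) {θ θ' : E → ℝ}
    (h : ∀ e, |θ e| ≤ π / 2 - ρ) (h' : ∀ e, |θ' e| ≤ π / 2 - ρ) (w w₀ : K → ℝ) :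
    0 ≤ P.energy θ w₀ θ' w :=
  add_nonneg (Finset.sum_nonneg fun e _ => potential_nonneg hρ hsin h h' e)
    (Finset.sum_nonneg fun k _ => kinetic_nonneg w w₀ k)

theorem continuous_energy (η₀ : E → ℝ) (u₀ : K → ℝ) :
    Continuous fun x : (E → ℝ) × (K → ℝ) => P.energy η₀ u₀ x.1 x.2 := by
  unfold energy
  fun_prop

/-- An energy level below which angles cannot leave a box around the rest point. -/
theorem angle_lt_of_energy_lt (ht : P.IsTrajectory η u u') (h : P.IsRest η₀ u₀) {ρ w : ℝ}
    (hρ : 0 < ρ) (hsin : 0 ≤ sin ρ) (hη₀ : ∀ e, |η₀ e| + 2 * ρ ≤ π / 2)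
    (hw : ∀ e, w ≤ P.B e * (sin ρ / 2 * ρ ^ 2)) (hstart : ‖η 0 - η₀‖ < ρ)
    (hE : P.energy η₀ u₀ (η 0) (u 0) < w) {t : ℝ} (h0 : 0 ≤ t) : ‖η t - η₀‖ < ρ := by
  by_contra! hcon
  have hcont : ContinuousOn (fun t => ‖η t - η₀‖) (Set.Icc 0 t) := by
    refine (ContinuousOn.sub (continuousOn_pi.2 fun e s hs => ?_) continuousOn_const).norm
    exact (ht.hasDeriv_angle e s hs.1).continuousWithinAt.mono Set.Icc_subset_Ici_self
  -- At a time when the deviation is exactly `ρ`, some angle has moved by `ρ` while all are still in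
  -- the convexity region, so the energy there is at least `w`, contrary to its monotonicity.
  obtain ⟨s, hs, hsρ⟩ := intermediate_value_Icc h0 hcont ⟨hstart.le, hcon⟩
  simp only at hsρ
  have hle : ∀ e, |η s e - η₀ e| ≤ ρ := fun e => by
    have := norm_le_pi_norm (η s - η₀) e
    rw [hsρ] at this
    simpa using this
  obtain ⟨e, he⟩ : ∃ e, ρ ≤ |η s e - η₀ e| := by
    by_contra! hall
    have : ‖η s - η₀‖ < ρ := (pi_norm_lt_iff hρ).2 fun e => by simpa using hall e
    linarith
  have hηs : ∀ e, |η s e| ≤ π / 2 - ρ := fun e => by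
    have := abs_sub_abs_le_abs_sub (η s e) (η₀ e)
    linarith [hle e, hη₀ e]
  have h1 := mul_sq_angle_le_energy (P := P) hρ hsin (fun e => by linarith [hη₀ e] :
    ∀ e, |η₀ e| ≤ π / 2 - ρ) hηs (u s) u₀ e
  have h2 : ρ ^ 2 ≤ (η s e - η₀ e) ^ 2 := by
    rw [← sq_abs (η s e - η₀ e)]
    gcongr
  have h3 := energy_antitone ht h (Set.mem_Ici.2 le_rfl) (Set.mem_Ici.2 hs.1) hs.1
  have h4 : P.B e * (sin ρ / 2 * ρ ^ 2) ≤ P.B e * (sin ρ / 2 * (η s e - η₀ e) ^ 2) := by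
    have := (P.B_pos e).le
    gcongr
  simp only at h3
  linarith [hw e]

/-- The kinetic term bounds the variables with `μ k ≠ 0`. Where `μ k = 0`, the force equation is
algebraic: `d k > 0` lets it be solved for `u k` in terms of sines and of variables with inertia, as
`J` does not couple two massless ones. -/
theorem bdd_of_kinetic_bdd (ht : P.IsTrajectory η u u') {C : ℝ}
    (hC : ∀ k t, 0 ≤ t → P.μ k / 2 * (u t k - u₀ k) ^ 2 ≤ C) (k : K) :
    BddOnPos fun t => u t k := by
  have hpos : ∀ k, P.μ k ≠ 0 → BddOnPos fun t => u t k := by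
    intro k hk
    have hk : 0 < P.μ k := lt_of_le_of_ne (P.μ_nonneg k) (Ne.symm hk)
    refine ⟨|u₀ k| + sqrt (2 * C / P.μ k), fun t h0 => ?_⟩
    have h1 : |u t k - u₀ k| ≤ sqrt (2 * C / P.μ k) := by
      refine Real.abs_le_sqrt ?_
      rw [le_div_iff₀ hk]
      linarith [hC k t h0]
    have := abs_sub_abs_le_abs_sub (u t k) (u₀ k)
    linarith
  by_cases hk : P.μ k = 0
  · have hd := P.d_pos k hk
    have hb : BddOnPos fun t => (P.d k)⁻¹ *
        (P.c k - (∑ e, P.Γ e k * (P.B e * sin (η t e))) - ∑ l, P.J k l * u t l) := by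
      refine BddOnPos.const_mul _ (((BddOnPos.const _).sub (BddOnPos.sum _ fun e =>
        ((BddOnPos.sin _).const_mul _).const_mul _)).sub (BddOnPos.sum _ fun l => ?_))
      by_cases hl : P.μ l = 0
      · simpa [P.J_eq_zero k l hk hl] using BddOnPos.const 0
      · exact (hpos l hl).const_mul _
    obtain ⟨D, hD⟩ := hb
    refine ⟨D, fun t h0 => ?_⟩
    have h1 := hD t h0
    have h2 := ht.force_eq k t h0
    rw [hk, zero_mul, force] at h2
    have : u t k = (P.d k)⁻¹ *
        (P.c k - (∑ e, P.Γ e k * (P.B e * sin (η t e))) - ∑ l, P.J k l * u t l) := by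
      rw [eq_inv_mul_iff_mul_eq₀ hd.ne']
      linarith
    simpa only [this] using h1
  · exact hpos k hk

theorem lip_angle_of_bdd (ht : P.IsTrajectory η u u') (hb : ∀ k, BddOnPos fun t => u t k) (e : E) :
    LipOnPos fun t => η t e :=
  LipOnPos.of_deriv (ht.hasDeriv_angle e) (BddOnPos.sum _ fun k => (hb k).const_mul _)

/-- With inertia, the derivative is a multiple of the force, hence bounded. Without inertia, the
algebraic formula for the variable has Lipschitz ingredients; no bound on its derivative is
available or needed. -/
theorem lip_of_bdd (ht : P.IsTrajectory η u u') (hb : ∀ k, BddOnPos fun t => u t k) (k : K) :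
    LipOnPos fun t => u t k := by
  have hf : ∀ k, BddOnPos fun t => P.force (η t) (u t) k := fun k => by
    have h1 : BddOnPos fun t => (-1) * ∑ e, P.Γ e k * (P.B e * sin (η t e)) :=
      (BddOnPos.sum _ fun e => ((BddOnPos.sin _).const_mul _).const_mul _).const_mul _
    have := ((h1.sub ((hb k).const_mul (P.d k))).sub
      (BddOnPos.sum Finset.univ fun l => (hb l).const_mul (P.J k l))).add (BddOnPos.const (P.c k))
    simpa only [force, neg_one_mul] using this
  have hpos : ∀ k, P.μ k ≠ 0 → LipOnPos fun t => u t k := by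
    intro k hk
    refine LipOnPos.of_deriv (ht.hasDeriv k) ?_
    obtain ⟨C, hC⟩ := (hf k).const_mul (P.μ k)⁻¹
    refine ⟨C, fun t h0 => ?_⟩
    have := hC t h0
    simp only at this
    rwa [← ht.force_eq k t h0, inv_mul_cancel_left₀ hk] at this
  by_cases hk : P.μ k = 0
  · have hd := P.d_pos k hk
    have hb : LipOnPos fun t => (P.d k)⁻¹ *
        (P.c k - (∑ e, P.Γ e k * (P.B e * sin (η t e))) - ∑ l, P.J k l * u t l) := by
      refine LipOnPos.const_mul _ (((LipOnPos.const _).sub (LipOnPos.sum _ fun e =>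
        ((lip_angle_of_bdd ht hb e).sin.const_mul _).const_mul _)).sub
          (LipOnPos.sum _ fun l => ?_))
      by_cases hl : P.μ l = 0
      · simpa [P.J_eq_zero k l hk hl] using LipOnPos.const 0
      · exact (hpos l hl).const_mul _
    obtain ⟨D, hD⟩ := hb
    have he : ∀ t, 0 ≤ t → u t k = (P.d k)⁻¹ *
        (P.c k - (∑ e, P.Γ e k * (P.B e * sin (η t e))) - ∑ l, P.J k l * u t l) := by
      intro t h0
      have h2 := ht.force_eq k t h0
      rw [hk, zero_mul, force] at h2
      rw [eq_inv_mul_iff_mul_eq₀ hd.ne']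
      linarith
    refine ⟨D, fun s t hs h0 => ?_⟩
    simpa only [he s hs, he t h0] using hD s t hs h0
  · exact hpos k hk

theorem lip_force_of_bdd (ht : P.IsTrajectory η u u') (hb : ∀ k, BddOnPos fun t => u t k) (k : K) :
    LipOnPos fun t => P.force (η t) (u t) k := by
  have hl := lip_of_bdd ht hb
  have h1 : LipOnPos fun t => (-1) * ∑ e, P.Γ e k * (P.B e * sin (η t e)) :=
    (LipOnPos.sum _ fun e =>
      ((lip_angle_of_bdd ht hb e).sin.const_mul _).const_mul _).const_mul _
  have := ((h1.sub ((hl k).const_mul (P.d k))).sub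
    (LipOnPos.sum Finset.univ fun l => (hl l).const_mul (P.J k l))).add (LipOnPos.const (P.c k))
  simpa only [force, neg_one_mul] using this

/-- The velocity-like variables of a trajectory of bounded energy converge to those of the rest
point, and all forces vanish in the limit. -/
theorem tendsto_of_bdd (ht : P.IsTrajectory η u u') (h : P.IsRest η₀ u₀)
    (hb : ∀ k, BddOnPos fun t => u t k)
    (hE : ∀ t, 0 ≤ t → 0 ≤ P.energy η₀ u₀ (η t) (u t)) :
    (∀ k, Tendsto (fun t => u t k) atTop (𝓝 (u₀ k))) ∧
      ∀ k, Tendsto (fun t => P.force (η t) (u t) k) atTop (𝓝 0) := by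
  -- Barbalat's lemma for `μ k * u k`, whose derivative is the force; this also covers `μ k = 0`.
  have hforce : ∀ k, Tendsto (fun t => u t k) atTop (𝓝 (u₀ k)) →
      Tendsto (fun t => P.force (η t) (u t) k) atTop (𝓝 0) := by
    intro k hk
    refine (lip_force_of_bdd ht hb k).tendsto_deriv (g := fun t => P.μ k * u t k)
      (l := P.μ k * u₀ k) (fun t h0 => ?_) (hk.const_mul _)
    rw [← ht.force_eq k t h0]
    exact (ht.hasDeriv k t h0).const_mul _
  obtain ⟨l, hl⟩ : ∃ l, Tendsto (fun t => P.energy η₀ u₀ (η t) (u t)) atTop (𝓝 l) := by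
    have hanti : Antitone fun t => P.energy η₀ u₀ (η (max t 0)) (u (max t 0)) := fun s t hst =>
      energy_antitone ht h (Set.mem_Ici.2 (le_max_right _ _)) (Set.mem_Ici.2 (le_max_right _ _))
        (max_le_max_right 0 hst)
    have hbdd : BddBelow (Set.range fun t => P.energy η₀ u₀ (η (max t 0)) (u (max t 0))) :=
      ⟨0, by rintro _ ⟨t, rfl⟩; exact hE _ (le_max_right _ _)⟩
    refine ⟨_, (tendsto_atTop_ciInf hanti hbdd).congr' ?_⟩
    filter_upwards [eventually_ge_atTop 0] with t h0
    rw [max_eq_left h0]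
  -- Barbalat's lemma for the energy, which is monotone and bounded below: the dissipation tends to
  -- zero.
  have hW : Tendsto (fun t => -∑ k, P.d k * (u t k - u₀ k) ^ 2) atTop (𝓝 0) := by
    refine LipOnPos.tendsto_deriv ?_ (fun t h0 => hasDeriv_energy ht h h0) hl
    have h1 : LipOnPos fun t => (-1) * ∑ k, P.d k * (u t k - u₀ k) ^ 2 :=
      (LipOnPos.sum _ fun k => (((lip_of_bdd ht hb k).sub (LipOnPos.const _)).sq
        ((hb k).sub (BddOnPos.const _))).const_mul _).const_mul _
    simpa only [neg_one_mul] using h1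
  have hpos : ∀ k, 0 < P.d k → Tendsto (fun t => u t k) atTop (𝓝 (u₀ k)) := by
    intro k hk
    have h1 : Tendsto (fun t => (u t k - u₀ k) ^ 2) atTop (𝓝 0) := by
      refine squeeze_zero (fun t => sq_nonneg _) (fun t => ?_)
        (by simpa using hW.neg.const_mul (P.d k)⁻¹)
      rw [le_inv_mul_iff₀ hk]
      exact Finset.single_le_sum (f := fun k => P.d k * (u t k - u₀ k) ^ 2)
        (fun k _ => mul_nonneg (P.d_nonneg k) (sq_nonneg _)) (Finset.mem_univ k)
    have h2 : Tendsto (fun t => |u t k - u₀ k|) atTop (𝓝 0) := by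
      simpa [Real.sqrt_sq_eq_abs] using h1.sqrt
    exact tendsto_sub_nhds_zero_iff.1 ((tendsto_zero_iff_abs_tendsto_zero _).2 h2)
  have hall : ∀ k, Tendsto (fun t => u t k) atTop (𝓝 (u₀ k)) := by
    intro k
    rcases (P.d_nonneg k).lt_or_eq with hk | hk
    · exact hpos k hk
    -- The force on the damped variable `l` contains no spring, and every term of it except `J l k *
    -- (u k - u₀ k)` is already known to vanish in the limit.
    · obtain ⟨l, hΓ, hl, hJ, hJ'⟩ := P.detect k hk.symm
      classical
      have h1 := hforce l (hpos l hl)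
      have h2 : Tendsto (fun t => ∑ k' ∈ Finset.univ.erase k, P.J l k' * (u t k' - u₀ k')) atTop
          (𝓝 (∑ k' ∈ Finset.univ.erase k, 0)) := by
        refine tendsto_finsetSum _ fun k' hk' => ?_
        rcases (P.d_nonneg k').lt_or_eq with hk'' | hk''
        · simpa using ((hpos k' hk'').sub_const (u₀ k')).const_mul (P.J l k')
        · simp [hJ' k' (Finset.ne_of_mem_erase hk') hk''.symm]
      have h3 : Tendsto (fun t => P.d l * (u t l - u₀ l)) atTop (𝓝 0) := by
        simpa using ((hpos l hl).sub_const (u₀ l)).const_mul (P.d l)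
      have h4 : Tendsto (fun t => u t k - u₀ k) atTop (𝓝 0) := by
        have h5 := (((h1.add h3).add h2).const_mul (-(P.J l k)⁻¹))
        simp only [Finset.sum_const_zero, add_zero, mul_zero] at h5
        refine h5.congr fun t => ?_
        rw [h.force_sub, ← Finset.add_sum_erase _ _ (Finset.mem_univ k)]
        simp only [hΓ, zero_mul, Finset.sum_const_zero]
        field_simp
        ring
      exact tendsto_sub_nhds_zero_iff.1 h4
  exact ⟨hall, fun k => hforce k (hall k)⟩

/-- A trajectory whose angles stay in a compact box inside `(-π/2, π/2)`, and along which the other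
variables and the forces converge, converges. -/
theorem exists_tendsto_angle (ht : P.IsTrajectory η u u') (h : P.IsRest η₀ u₀) {ρ : ℝ}
    (hρ : 0 < ρ) (hsin : 0 < sin ρ)
    (hball : ∀ θ : E → ℝ, ‖θ - η₀‖ ≤ ρ → ∀ e, |θ e| ≤ π / 2 - ρ)
    (hnear : ∀ t, 0 ≤ t → ‖η t - η₀‖ < ρ) (hu' : Tendsto u atTop (𝓝 u₀))
    (hf : ∀ k, Tendsto (fun t => P.force (η t) (u t) k) atTop (𝓝 0)) :
    ∃ η₁, Tendsto η atTop (𝓝 η₁) := by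
  have hbox : ∀ t, 0 ≤ t → ∀ e, |η t e| ≤ π / 2 - ρ := fun t h0 => hball _ (hnear t h0).le
  -- The box confines the angles to a compact set; a cluster point is the only candidate limit, and
  -- an ultrafilter refining `atTop` plays the role of a subsequence.
  obtain ⟨η₁, hη₁, hcl⟩ := (isCompact_closedBall η₀ ρ).exists_mapClusterPt
    (f := atTop) (u := η) (by
      rw [le_principal_iff, mem_map]
      filter_upwards [eventually_ge_atTop 0] with t h0
      rw [Set.mem_preimage, Metric.mem_closedBall, dist_eq_norm]
      exact (hnear t h0).le)
  have hη₁' : ∀ e, |η₁ e| ≤ π / 2 - ρ := hball _ (by simpa [dist_eq_norm] using hη₁)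
  obtain ⟨F, hF, hηF⟩ := mapClusterPt_iff_ultrafilter.1 hcl
  have hlim : Tendsto (fun t => (η t, u t)) F (𝓝 (η₁, u₀)) :=
    hηF.prodMk_nhds (hu'.mono_left hF)
  have hrest : P.IsRest η₁ u₀ := by
    refine ⟨h.angle, fun k => ?_⟩
    have hc : Continuous fun x : (E → ℝ) × (K → ℝ) => P.force x.1 x.2 k := by
      unfold force
      fun_prop
    exact tendsto_nhds_unique ((hc.tendsto (η₁, u₀)).comp hlim) ((hf k).mono_left hF)
  -- The energy is now measured from the new rest point. It is nonincreasing, and small at one time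
  -- by clustering, so it is small at all later times.
  have hE₁ : Tendsto (fun t => P.energy η₁ u₀ (η t) (u t)) atTop (𝓝 0) := by
    rw [Metric.tendsto_atTop]
    intro ε hε
    have h1 := Tendsto.comp ((P.continuous_energy η₁ u₀).tendsto (η₁, u₀)) hlim
    simp only [Function.comp_def] at h1
    have h2 : P.energy η₁ u₀ η₁ u₀ = 0 := by simp [energy]
    rw [h2] at h1
    obtain ⟨T, hT, hT0⟩ := ((h1.eventually_lt_const hε).and
      ((eventually_ge_atTop 0).filter_mono hF)).exists
    refine ⟨T, fun t hTt => ?_⟩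
    have h0 : 0 ≤ t := hT0.trans hTt
    have h3 := energy_antitone ht hrest (Set.mem_Ici.2 hT0) (Set.mem_Ici.2 h0) hTt
    rw [Real.dist_eq, sub_zero, abs_of_nonneg
      (energy_nonneg hρ hsin.le hη₁' (hbox t h0) _ _)]
    exact lt_of_le_of_lt h3 hT
  refine ⟨η₁, tendsto_pi_nhds.2 fun e => ?_⟩
  have hc : 0 < P.B e * (sin ρ / 2) := mul_pos (P.B_pos e) (half_pos hsin)
  have h1 : Tendsto (fun t => (η t e - η₁ e) ^ 2) atTop (𝓝 0) := by
    refine squeeze_zero' (Eventually.of_forall fun t => sq_nonneg _) ?_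
      (by simpa only [mul_zero] using hE₁.const_mul (P.B e * (sin ρ / 2))⁻¹)
    filter_upwards [eventually_ge_atTop 0] with t h0
    rw [le_inv_mul_iff₀ hc, mul_assoc]
    exact mul_sq_angle_le_energy hρ hsin.le hη₁' (hbox t h0) _ _ e
  have h2 : Tendsto (fun t => |η t e - η₁ e|) atTop (𝓝 0) := by
    simpa [Real.sqrt_sq_eq_abs] using h1.sqrt
  exact tendsto_sub_nhds_zero_iff.1 ((tendsto_zero_iff_abs_tendsto_zero _).2 h2)

/-- Rest points with angles in `(-π/2, π/2)` attract: trajectories which start nearby converge. -/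
theorem IsRest.exists_nhds_tendsto (h : P.IsRest η₀ u₀) (hη₀ : ∀ e, |η₀ e| < π / 2) :
    ∃ V : Set ((E → ℝ) × (K → ℝ)), IsOpen V ∧ (η₀, u₀) ∈ V ∧
      ∀ η u u', P.IsTrajectory η u u' → (η 0, u 0) ∈ V →
        (∃ η₁, Tendsto η atTop (𝓝 η₁)) ∧ Tendsto u atTop (𝓝 u₀) := by
  -- One `ρ` is for the motion of the angles, the other keeps them a distance `ρ` away from `±π/2`.
  obtain ⟨ρ, hρ, hρπ, hρη⟩ : ∃ ρ, 0 < ρ ∧ ρ < π ∧ ∀ e, |η₀ e| + 2 * ρ ≤ π / 2 := by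
    have h1 : ∀ᶠ ρ in 𝓝 (0 : ℝ), ρ < π ∧ ∀ e, |η₀ e| + 2 * ρ ≤ π / 2 := by
      refine (eventually_lt_nhds pi_pos).and (eventually_all.2 fun e => ?_)
      have : Tendsto (fun ρ : ℝ => |η₀ e| + 2 * ρ) (𝓝 0) (𝓝 (|η₀ e| + 2 * 0)) :=
        (Continuous.tendsto (by fun_prop) _)
      exact this.eventually (Iic_mem_nhds (by simpa using hη₀ e))
    obtain ⟨ρ, hρ, hρ'⟩ := ((h1.filter_mono nhdsWithin_le_nhds).and
      (self_mem_nhdsWithin (s := Set.Ioi (0 : ℝ)))).exists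
    exact ⟨ρ, hρ', hρ⟩
  have hsin : 0 < sin ρ := sin_pos_of_pos_of_lt_pi hρ hρπ
  obtain ⟨w, hw0, hw⟩ : ∃ w, 0 < w ∧ ∀ e, w ≤ P.B e * (sin ρ / 2 * ρ ^ 2) := by
    have h1 : ∀ᶠ w in 𝓝 (0 : ℝ), ∀ e, w ≤ P.B e * (sin ρ / 2 * ρ ^ 2) := by
      refine eventually_all.2 fun e => Iic_mem_nhds ?_
      have := P.B_pos e
      positivity
    obtain ⟨w, hw, hw'⟩ := ((h1.filter_mono nhdsWithin_le_nhds).and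
      (self_mem_nhdsWithin (s := Set.Ioi (0 : ℝ)))).exists
    exact ⟨w, hw', hw⟩
  refine ⟨{x | ‖x.1 - η₀‖ < ρ ∧ P.energy η₀ u₀ x.1 x.2 < w}, ?_, ?_, ?_⟩
  · exact (isOpen_lt (f := fun x : (E → ℝ) × (K → ℝ) => ‖x.1 - η₀‖) (by fun_prop)
      continuous_const).inter
      (isOpen_lt (continuous_energy _ _) continuous_const)
  · simp [energy, hρ, hw0]
  · rintro η u u' ht ⟨hs1, hs2⟩
    have hnear : ∀ t, 0 ≤ t → ‖η t - η₀‖ < ρ := fun t h0 =>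
      angle_lt_of_energy_lt ht h hρ hsin.le hρη hw hs1 hs2 h0
    have hbox₀ : ∀ e, |η₀ e| ≤ π / 2 - ρ := fun e => by linarith [hρη e]
    have hball : ∀ θ : E → ℝ, ‖θ - η₀‖ ≤ ρ → ∀ e, |θ e| ≤ π / 2 - ρ := fun θ hθ e => by
      have h1 : |θ e - η₀ e| ≤ ρ := (norm_le_pi_norm (θ - η₀) e).trans hθ
      have := abs_sub_abs_le_abs_sub (θ e) (η₀ e)
      linarith [hρη e]
    have hbox : ∀ t, 0 ≤ t → ∀ e, |η t e| ≤ π / 2 - ρ := fun t h0 =>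
      hball _ (hnear t h0).le
    have hE : ∀ t, 0 ≤ t → P.energy η₀ u₀ (η t) (u t) ≤ P.energy η₀ u₀ (η 0) (u 0) :=
      fun t h0 => energy_antitone ht h (Set.mem_Ici.2 le_rfl) (Set.mem_Ici.2 h0) h0
    have hb : ∀ k, BddOnPos fun t => u t k := bdd_of_kinetic_bdd (u₀ := u₀) ht fun k t h0 =>
      (kinetic_le_energy hρ hsin.le hbox₀ (hbox t h0) (u t) u₀ k).trans (hE t h0)
    obtain ⟨hu, hf⟩ := tendsto_of_bdd ht h hb fun t h0 =>
      energy_nonneg hρ hsin.le hbox₀ (hbox t h0) _ _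
    have hu' : Tendsto u atTop (𝓝 u₀) := tendsto_pi_nhds.2 hu
    exact ⟨exists_tendsto_angle ht h hρ hsin hball hnear hu' hf, hu'⟩

end PassiveNetwork

/-! ### A storage with first-order controllers -/

/-- `exists_tendsto_of_hasDerivWithinAt_linear` for unbundled linear and bilinear maps. -/
theorem exists_tendsto_of_isLinearMap {Z : Type*} [NormedAddCommGroup Z] [NormedSpace ℝ Z]
    [FiniteDimensional ℝ Z] {A : Z → Z} (hA : IsLinearMap ℝ A) {B : Z → Z → ℝ}
    (hB : ∀ z, IsLinearMap ℝ (B z)) (hsymm : ∀ y z, B y z = B z y)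
    (hpos : ∀ z, z ≠ 0 → 0 < B z z) (hneg : ∀ z, z ≠ 0 → B z (A z) < 0) {z b : ℝ → Z} {b₀ : Z}
    (hz : ∀ t, 0 ≤ t → HasDerivWithinAt z (A (z t) + b t) (Set.Ici 0) t)
    (hb : Tendsto b atTop (𝓝 b₀)) : ∃ z₀, Tendsto z atTop (𝓝 z₀) := by
  let A' : Z →L[ℝ] Z := LinearMap.toContinuousLinearMap hA.mk'
  let B₁ : Z →ₗ[ℝ] Z →ₗ[ℝ] ℝ := LinearMap.mk₂ ℝ B
    (fun x y z => by rw [hsymm, (hB z).map_add, hsymm z, hsymm z])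
    (fun c x y => by rw [hsymm, (hB y).map_smul, hsymm y])
    (fun x y z => (hB x).map_add y z) (fun c x y => (hB x).map_smul c y)
  exact exists_tendsto_of_hasDerivWithinAt_linear (A := A') (B := B₁.toContinuousBilinearMap)
    hsymm hpos hneg hz hb

/-- A storage `y` with first-order controllers `h` driven by a converging disturbance `p`:
`V y' = ∑ h + p`, `τ h' = -h - y / Q`. -/
theorem exists_tendsto_storage {ι : Type*} [Fintype ι] [Nonempty ι] {V : ℝ} (hV : 0 < V)
    {Q τ : ι → ℝ} (hQ : ∀ i, 0 < Q i) (hτ : ∀ i, 0 < τ i) {y y' p : ℝ → ℝ} {h h' : ℝ → ι → ℝ}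
    (hy : ∀ t, 0 ≤ t → HasDerivWithinAt y (y' t) (Set.Ici 0) t)
    (hh : ∀ i t, 0 ≤ t → HasDerivWithinAt (fun t => h t i) (h' t i) (Set.Ici 0) t)
    (hy' : ∀ t, 0 ≤ t → V * y' t = ∑ i, h t i + p t)
    (hh' : ∀ i t, 0 ≤ t → τ i * h' t i = -h t i - 1 / Q i * y t)
    {p₀ : ℝ} (hp : Tendsto p atTop (𝓝 p₀)) :
    ∃ z : ℝ × (ι → ℝ), Tendsto y atTop (𝓝 z.1) ∧ Tendsto h atTop (𝓝 z.2) := by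
  set R := ∑ i, 1 / Q i with hR
  have hRpos : 0 < R := Finset.sum_pos (fun i _ => one_div_pos.2 (hQ i)) Finset.univ_nonempty
  set c := ∑ i, τ i ^ 2 / Q i with hc
  have hcpos : 0 < c :=
    Finset.sum_pos (fun i _ => div_pos (pow_pos (hτ i) 2) (hQ i)) Finset.univ_nonempty
  -- By Cauchy–Schwarz, `(S h)² ≤ c ∑ Q h²`. This `δ` lets the cross term produced by the correction
  -- in `B` be absorbed by half of `∑ Q h²`.
  set δ := V / (R * c) with hδ
  have hδpos : 0 < δ := by positivity
  let S : (ι → ℝ) → ℝ := fun h => ∑ i, τ i * h i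
  have hS : IsLinearMap ℝ S :=
    ⟨fun a b => by simp [S, mul_add, Finset.sum_add_distrib],
      fun a b => by simp only [S, Pi.smul_apply, smul_eq_mul, Finset.mul_sum]
                    exact Finset.sum_congr rfl fun i _ => by ring⟩
  let A : ℝ × (ι → ℝ) → ℝ × (ι → ℝ) := fun z =>
    ((∑ i, z.2 i) / V, fun i => (-z.2 i - 1 / Q i * z.1) / τ i)
  have hA : IsLinearMap ℝ A := by
    refine ⟨fun a b => ?_, fun r a => ?_⟩
    · ext i <;> simp [A, Finset.sum_add_distrib] <;> ring
    · ext i <;> simp [A, ← Finset.mul_sum] <;> ring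
  -- The natural energy dissipates only in `h`. The quantity `V y + ∑ τ h` has derivative `-R y` for
  -- the homogeneous system, so adding `δ` times its square makes the dissipation strict in `y` too.
  let B : ℝ × (ι → ℝ) → ℝ × (ι → ℝ) → ℝ := fun a b =>
    V * (a.1 * b.1) + ∑ i, Q i * τ i * (a.2 i * b.2 i)
      + δ * ((V * a.1 + S a.2) * (V * b.1 + S b.2))
  have hB : ∀ a, IsLinearMap ℝ (B a) := by
    refine fun a => ⟨fun b d => ?_, fun r b => ?_⟩
    · simp only [B, Prod.fst_add, Prod.snd_add, Pi.add_apply, hS.map_add, mul_add,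
        Finset.sum_add_distrib]
      ring
    · simp only [B, Prod.smul_fst, Prod.smul_snd, Pi.smul_apply, smul_eq_mul, hS.map_smul]
      have : ∑ i, Q i * τ i * (a.2 i * (r * b.2 i)) = r * ∑ i, Q i * τ i * (a.2 i * b.2 i) := by
        rw [Finset.mul_sum]
        exact Finset.sum_congr rfl fun i _ => by ring
      rw [this]
      ring
  have hne : ∀ z : ℝ × (ι → ℝ), z ≠ 0 → z.1 ≠ 0 ∨ ∃ i, z.2 i ≠ 0 := by
    intro z hz
    by_contra! hcon
    exact hz (Prod.ext hcon.1 (funext hcon.2))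
  have hquad : ∀ (w : ι → ℝ), (∀ i, 0 < w i) → ∀ z : ℝ × (ι → ℝ), z ≠ 0 → ∀ r, 0 < r →
      0 < r * z.1 ^ 2 + ∑ i, w i * z.2 i ^ 2 := by
    intro w hw z hz r hr
    have h1 : 0 ≤ ∑ i, w i * z.2 i ^ 2 :=
      Finset.sum_nonneg fun i _ => mul_nonneg (hw i).le (sq_nonneg _)
    rcases hne z hz with h0 | ⟨i, hi⟩
    · have : 0 < z.1 ^ 2 := by positivity
      positivity
    · have : 0 < w i * z.2 i ^ 2 := mul_pos (hw i) (by positivity)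
      have h2 := Finset.single_le_sum (f := fun i => w i * z.2 i ^ 2)
        (fun i _ => mul_nonneg (hw i).le (sq_nonneg _)) (Finset.mem_univ i)
      have : 0 ≤ r * z.1 ^ 2 := by positivity
      linarith
  suffices hex : ∃ z₀, Tendsto (fun t => (y t, h t)) atTop (𝓝 z₀) by
    obtain ⟨z₀, hz₀⟩ := hex
    exact ⟨z₀, (continuous_fst.tendsto z₀).comp hz₀, (continuous_snd.tendsto z₀).comp hz₀⟩
  refine exists_tendsto_of_isLinearMap (A := A) hA (B := B) hB
    (fun a b => by simp only [B, mul_comm]) (fun z hz => ?_) (fun z hz => ?_)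
    (z := fun t => (y t, h t)) (b := fun t => (p t / V, 0)) (b₀ := (p₀ / V, 0))
    (fun t ht => ?_) ((hp.div_const V).prodMk_nhds tendsto_const_nhds)
  · have h1 := hquad (fun i => Q i * τ i) (fun i => mul_pos (hQ i) (hτ i)) z hz V hV
    have h2 : 0 ≤ δ * ((V * z.1 + S z.2) * (V * z.1 + S z.2)) :=
      mul_nonneg hδpos.le (mul_self_nonneg _)
    simp only [B, ← sq] at h2 ⊢
    linarith
  · have e1 : B z (A z) = -(∑ i, Q i * z.2 i ^ 2) - δ * R * (V * z.1 ^ 2 + z.1 * S z.2) := by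
      have s1 : ∑ i, Q i * τ i * (z.2 i * ((-z.2 i - 1 / Q i * z.1) / τ i))
          = -(∑ i, Q i * z.2 i ^ 2) - z.1 * ∑ i, z.2 i := by
        rw [Finset.mul_sum, ← Finset.sum_neg_distrib, ← Finset.sum_sub_distrib]
        refine Finset.sum_congr rfl fun i _ => ?_
        have := (hQ i).ne'
        have := (hτ i).ne'
        field_simp
      have s2 : ∑ i, τ i * ((-z.2 i - 1 / Q i * z.1) / τ i) = -(∑ i, z.2 i) - R * z.1 := by
        rw [hR, Finset.sum_mul, ← Finset.sum_neg_distrib, ← Finset.sum_sub_distrib]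
        refine Finset.sum_congr rfl fun i _ => ?_
        have := (hτ i).ne'
        field_simp
      simp only [B, A, S, s1, s2]
      field_simp
      ring
    have h1 : S z.2 ^ 2 ≤ c * ∑ i, Q i * z.2 i ^ 2 := by
      refine Finset.sum_sq_le_sum_mul_sum_of_sq_le_mul _ (fun i _ => ?_) (fun i _ => ?_)
        fun i _ => ?_
      · exact (div_pos (pow_pos (hτ i) 2) (hQ i)).le
      · exact mul_nonneg (hQ i).le (sq_nonneg _)
      · have := (hQ i).ne'
        refine le_of_eq ?_
        field_simp
    have h2 := hquad Q hQ z hz (δ * R * V) (by positivity)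
    have h3 : δ * R * (-(z.1 * S z.2)) ≤ δ * R * (V / 2 * z.1 ^ 2 + S z.2 ^ 2 / (2 * V)) := by
      refine mul_le_mul_of_nonneg_left ?_ (by positivity)
      have : 0 ≤ (V * z.1 + S z.2) ^ 2 / (2 * V) := by positivity
      have e : (V * z.1 + S z.2) ^ 2 / (2 * V)
        = V / 2 * z.1 ^ 2 + S z.2 ^ 2 / (2 * V) + z.1 * S z.2 := by
        field_simp
        ring
      linarith
    have h4 : δ * R * (S z.2 ^ 2 / (2 * V)) ≤ (∑ i, Q i * z.2 i ^ 2) / 2 := by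
      have e : δ * R * (S z.2 ^ 2 / (2 * V)) = S z.2 ^ 2 / (2 * c) := by
        rw [hδ]
        field_simp
      rw [e, div_le_iff₀ (by positivity)]
      linarith
    rw [e1]
    linarith
  · have h1 : HasDerivWithinAt (fun t => (y t, h t)) (y' t, h' t) (Set.Ici 0) t :=
      (hy t ht).prodMk (hasDerivWithinAt_pi.2 fun i => hh i t ht)
    refine h1.congr_deriv ?_
    refine Prod.ext ?_ (funext fun i => ?_)
    · simp only [A, Prod.fst_add]
      rw [← add_div, eq_div_iff hV.ne', mul_comm, hy' t ht]
    · simp only [A, Prod.snd_add, Pi.add_apply, Pi.zero_apply, add_zero]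
      rw [eq_div_iff (hτ i).ne', mul_comm, hh' i t ht]

/-! ### Incidence sums and extension by zero -/

theorem sum_mul_sum_ite {α β : Type*} [Fintype α] [Fintype β] [DecidableEq β] (f : α → β)
    (g : α → ℝ) (φ : β → ℝ) :
    ∑ k, φ k * ∑ e, (if f e = k then g e else 0) = ∑ e, g e * φ (f e) := by
  simp only [Finset.mul_sum]
  rw [Finset.sum_comm]
  refine Finset.sum_congr rfl fun e _ => ?_
  simp [mul_comm]

section ExtendZero

variable {ι : Type*} [DecidableEq ι] {s : Finset ι}

theorem extendZero_eq_sum (f : s → ℝ) (i : ι) :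
    extendZero f i = ∑ j : s, if (j : ι) = i then f j else 0 := by
  unfold extendZero
  split_ifs with h
  · rw [Finset.sum_eq_single ⟨i, h⟩]
    · simp
    · intro j _ hj
      rw [if_neg fun hji => hj (Subtype.ext hji)]
    · simp
  · symm
    refine Finset.sum_eq_zero fun j _ => if_neg ?_
    rintro rfl
    exact h j.2

theorem extendZero_of_mem (f : s → ℝ) (j : s) : extendZero f j = f j := by
  simp [extendZero]

theorem extendZero_of_notMem (f : s → ℝ) {i : ι} (h : i ∉ s) : extendZero f i = 0 := by
  simp [extendZero, h]

theorem extendZero_nonneg {f : s → ℝ} (hf : ∀ j, 0 ≤ f j) (i : ι) : 0 ≤ extendZero f i := by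
  unfold extendZero
  split_ifs
  exacts [hf _, le_rfl]

theorem sum_extendZero [Fintype ι] (f : s → ℝ) : ∑ i, extendZero f i = ∑ j, f j := by
  simp only [extendZero_eq_sum]
  rw [Finset.sum_comm]
  simp

end ExtendZero

/-! ### The heating network: conservation, diffusion and convergence of temperatures -/

namespace CHPNetwork

variable {Ne Nh Eh : Type*} [Fintype Ne] [DecidableEq Ne] [Fintype Nh] [DecidableEq Nh]
  [Fintype Eh] [DecidableEq Eh] (N : CHPNetwork Ne Nh Eh)

theorem sum_V_pos : 0 < ∑ i, N.V i := by
  obtain ⟨k⟩ := N.connected.nonempty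
  exact Finset.sum_pos (fun i _ => N.V_pos i) ⟨.inr k, Finset.mem_univ _⟩

/-- The heat transported by the mass flows. -/
def heatFlow (T : Eh ⊕ Nh → ℝ) : Eh ⊕ Nh → ℝ :=
  Sum.elim (fun e => N.q e * (T (.inr (N.src e)) - T (.inl e))) fun k =>
    (∑ e, if N.tgt e = k then N.q e * T (.inl e) else 0)
      - (∑ e, if N.tgt e = k then N.q e else 0) * T (.inr k)

theorem isLinearMap_heatFlow : IsLinearMap ℝ N.heatFlow := by
  refine ⟨fun a b => ?_, fun r a => ?_⟩
  · ext i
    rcases i with e | k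
    · simp [heatFlow]; ring
    · simp only [heatFlow, Sum.elim_inr, Pi.add_apply]
      have : ∀ e, (if N.tgt e = k then N.q e * (a (.inl e) + b (.inl e)) else 0)
          = (if N.tgt e = k then N.q e * a (.inl e) else 0)
            + if N.tgt e = k then N.q e * b (.inl e) else 0 := fun e => by
        split_ifs <;> ring
      simp only [this, Finset.sum_add_distrib]
      ring
  · ext i
    rcases i with e | k
    · simp [heatFlow]; ring
    · simp only [heatFlow, Sum.elim_inr, Pi.smul_apply, smul_eq_mul]
      have : ∀ e, (if N.tgt e = k then N.q e * (r * a (.inl e)) else 0)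
          = r * if N.tgt e = k then N.q e * a (.inl e) else 0 := fun e => by
        split_ifs <;> ring
      simp only [this, ← Finset.mul_sum]
      ring

/-- Mass balance regrouped by node: each node value is weighted by the outgoing flow on one side and
by the equal incoming flow on the other. -/
theorem sum_q_src (φ : Nh → ℝ) : ∑ e, N.q e * φ (N.src e) = ∑ e, N.q e * φ (N.tgt e) := by
  rw [← sum_mul_sum_ite N.src, ← sum_mul_sum_ite N.tgt]
  exact Finset.sum_congr rfl fun k _ => by rw [N.q_balance k]

/-- Completing squares leaves half of `∑ q T(src)² - ∑ q T(tgt)²`, which vanishes by mass balance.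
Thus transport, though directed, dissipates like diffusion along each edge. -/
theorem sum_mul_heatFlow (T : Eh ⊕ Nh → ℝ) : ∑ i, T i * N.heatFlow T i =
    -(∑ e, N.q e * ((T (.inr (N.src e)) - T (.inl e)) ^ 2
      + (T (.inl e) - T (.inr (N.tgt e))) ^ 2)) / 2 := by
  rw [Fintype.sum_sum_type]
  simp only [heatFlow, Sum.elim_inl, Sum.elim_inr, mul_sub, Finset.sum_sub_distrib]
  rw [sum_mul_sum_ite]
  have h1 : ∑ k, T (.inr k) * ((∑ e, if N.tgt e = k then N.q e else 0) * T (.inr k))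
      = ∑ e, N.q e * T (.inr (N.tgt e)) ^ 2 := by
    rw [← sum_mul_sum_ite N.tgt N.q fun k => T (.inr k) ^ 2]
    exact Finset.sum_congr rfl fun k _ => by ring
  have h2 := N.sum_q_src fun k => T (.inr k) ^ 2
  rw [h1]
  have h3 : -(∑ e, N.q e * ((T (.inr (N.src e)) - T (.inl e)) ^ 2
      + (T (.inl e) - T (.inr (N.tgt e))) ^ 2)) / 2 =
      (∑ e, (T (.inl e) * (N.q e * T (.inr (N.src e))))
        - ∑ e, T (.inl e) * (N.q e * T (.inl e)) + (∑ e, N.q e * T (.inl e) * T (.inr (N.tgt e))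
        - ∑ e, N.q e * T (.inr (N.tgt e)) ^ 2))
      - ((∑ e, N.q e * T (.inr (N.src e)) ^ 2) - ∑ e, N.q e * T (.inr (N.tgt e)) ^ 2) / 2 := by
    rw [← Finset.sum_sub_distrib, ← Finset.sum_sub_distrib, ← Finset.sum_sub_distrib,
      ← Finset.sum_add_distrib, Finset.sum_div, ← Finset.sum_sub_distrib,
      ← Finset.sum_neg_distrib, Finset.sum_div]
    exact Finset.sum_congr rfl fun e _ => by ring
  rw [h3, h2]
  ring

theorem sum_heatFlow (T : Eh ⊕ Nh → ℝ) : ∑ i, N.heatFlow T i = 0 := by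
  rw [Fintype.sum_sum_type]
  simp only [heatFlow, Sum.elim_inl, Sum.elim_inr, mul_sub, Finset.sum_sub_distrib]
  have h1 := sum_mul_sum_ite N.tgt (fun e => N.q e * T (.inl e)) fun _ => 1
  have h2 : ∑ k, (∑ e, if N.tgt e = k then N.q e else 0) * T (.inr k)
      = ∑ e, N.q e * T (.inr (N.tgt e)) := by
    rw [← sum_mul_sum_ite N.tgt N.q fun k => T (.inr k)]
    exact Finset.sum_congr rfl fun k _ => by ring
  simp only [one_mul, mul_one] at h1
  rw [h1, h2, N.sum_q_src fun k => T (.inr k)]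
  ring

theorem eq_of_forall_edge {T : Eh ⊕ Nh → ℝ} (h1 : ∀ e, T (.inr (N.src e)) = T (.inl e))
    (h2 : ∀ e, T (.inl e) = T (.inr (N.tgt e))) (i j : Eh ⊕ Nh) : T i = T j := by
  have hw : ∀ k l, T (.inr k) = T (.inr l) := by
    intro k l
    obtain ⟨w⟩ := N.connected.preconnected k l
    induction w with
    | nil => rfl
    | cons hadj _ ih =>
      refine Eq.trans ?_ ih
      rcases (SimpleGraph.fromRel_adj _ _ _).1 hadj with ⟨_, ⟨e, rfl, rfl⟩ | ⟨e, rfl, rfl⟩⟩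
      · exact (h1 e).trans (h2 e)
      · exact ((h1 e).trans (h2 e)).symm
  have hE : ∀ i : Eh ⊕ Nh, ∃ k, T i = T (.inr k) := by
    rintro (e | k)
    · exact ⟨_, h2 e⟩
    · exact ⟨k, rfl⟩
  obtain ⟨k, hk⟩ := hE i
  obtain ⟨l, hl⟩ := hE j
  rw [hk, hl, hw k l]

/-- The temperatures converge as soon as their average and the heat injections do. -/
theorem exists_tendsto_temperature {T T' b : ℝ → Eh ⊕ Nh → ℝ} {b₀ : Eh ⊕ Nh → ℝ} {θ : ℝ}
    (hT : ∀ i t, 0 ≤ t → HasDerivWithinAt (fun t => T t i) (T' t i) (Set.Ici 0) t)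
    (hT' : ∀ i t, 0 ≤ t → N.V i * T' t i = N.heatFlow (T t) i + b t i)
    (hb : Tendsto b atTop (𝓝 b₀))
    (hθ : Tendsto (fun t => (∑ i, N.V i * T t i) / ∑ i, N.V i) atTop (𝓝 θ)) :
    ∃ T₀, Tendsto T atTop (𝓝 T₀) := by
  have hVt := N.sum_V_pos
  let avg : (Eh ⊕ Nh → ℝ) → ℝ := fun T => (∑ i, N.V i * T i) / ∑ i, N.V i
  -- The heat flow alone is only semidefinite, as constants are in its kernel. Subtracting the
  -- average makes it strictly dissipative; the average is added back to the input, where its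
  -- convergence is a hypothesis.
  let A : (Eh ⊕ Nh → ℝ) → (Eh ⊕ Nh → ℝ) := fun T i => N.heatFlow T i / N.V i - avg T
  have hA : IsLinearMap ℝ A := by
    refine ⟨fun x y => ?_, fun r x => ?_⟩
    · ext i
      simp only [A, avg, N.isLinearMap_heatFlow.map_add, Pi.add_apply, mul_add,
        Finset.sum_add_distrib]
      ring
    · ext i
      have : ∑ i, N.V i * (r * x i) = r * ∑ i, N.V i * x i := by
        rw [Finset.mul_sum]
        exact Finset.sum_congr rfl fun i _ => by ring
      simp only [A, avg, N.isLinearMap_heatFlow.map_smul, Pi.smul_apply, smul_eq_mul, this]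
      ring
  let B : (Eh ⊕ Nh → ℝ) → (Eh ⊕ Nh → ℝ) → ℝ := fun x y => ∑ i, N.V i * (x i * y i)
  have hB : ∀ x, IsLinearMap ℝ (B x) := by
    refine fun x => ⟨fun y z => ?_, fun r y => ?_⟩
    · simp only [B, Pi.add_apply, mul_add, Finset.sum_add_distrib]
    · simp only [B, Pi.smul_apply, smul_eq_mul, Finset.mul_sum]
      exact Finset.sum_congr rfl fun i _ => by ring
  refine exists_tendsto_of_isLinearMap hA hB (fun x y => by simp only [B, mul_comm])
    (fun x hx => ?_) (fun x hx => ?_) (b := fun t i => b t i / N.V i + avg (T t))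
    (b₀ := fun i => b₀ i / N.V i + θ) (fun t ht => ?_) ?_
  · obtain ⟨i, hi⟩ := Function.ne_iff.1 hx
    refine Finset.sum_pos' (fun i _ => mul_nonneg (N.V_pos i).le (mul_self_nonneg _))
      ⟨i, Finset.mem_univ _, mul_pos (N.V_pos i) (mul_self_pos.2 hi)⟩
  · have e : B x (A x) = ∑ i, x i * N.heatFlow x i - avg x ^ 2 * ∑ i, N.V i := by
      have h1 : B x (A x) = ∑ i, x i * N.heatFlow x i - avg x * ∑ i, N.V i * x i := by
        simp only [B, A]
        rw [Finset.mul_sum, ← Finset.sum_sub_distrib]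
        refine Finset.sum_congr rfl fun i _ => ?_
        have := (N.V_pos i).ne'
        field_simp
      have h2 : ∑ i, N.V i * x i = avg x * ∑ i, N.V i := by
        simp only [avg]
        field_simp
      rw [h1, h2]
      ring
    rw [e, N.sum_mul_heatFlow]
    have hnn : ∀ e ∈ Finset.univ, 0 ≤ N.q e * ((x (.inr (N.src e)) - x (.inl e)) ^ 2
        + (x (.inl e) - x (.inr (N.tgt e))) ^ 2) := fun e _ =>
      mul_nonneg (N.q_pos e).le (by positivity)
    have hsum := Finset.sum_nonneg hnn
    have havg : 0 ≤ avg x ^ 2 * ∑ i, N.V i := by positivity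
    -- Zero dissipation forces equal temperatures across every edge, hence a constant by
    -- connectedness, and then zero because the average is zero.
    by_contra! hcon
    have hs0 : ∑ e, N.q e * ((x (.inr (N.src e)) - x (.inl e)) ^ 2
        + (x (.inl e) - x (.inr (N.tgt e))) ^ 2) = 0 := by linarith
    have ha0 : avg x ^ 2 * ∑ i, N.V i = 0 := by linarith
    have hz := (Finset.sum_eq_zero_iff_of_nonneg hnn).1 hs0
    have hz' : ∀ e, (x (.inr (N.src e)) - x (.inl e)) ^ 2
        + (x (.inl e) - x (.inr (N.tgt e))) ^ 2 = 0 := fun e =>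
      (mul_eq_zero.1 (hz e (Finset.mem_univ e))).resolve_left (N.q_pos e).ne'
    have hconst := N.eq_of_forall_edge (T := x)
      (fun e => sub_eq_zero.1 (pow_eq_zero_iff two_ne_zero |>.1 (by
        linarith [hz' e, sq_nonneg (x (.inr (N.src e)) - x (.inl e)),
          sq_nonneg (x (.inl e) - x (.inr (N.tgt e)))])))
      (fun e => sub_eq_zero.1 (pow_eq_zero_iff two_ne_zero |>.1 (by
        linarith [hz' e, sq_nonneg (x (.inr (N.src e)) - x (.inl e)),
          sq_nonneg (x (.inl e) - x (.inr (N.tgt e)))])))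
    obtain ⟨i, hi⟩ := Function.ne_iff.1 hx
    have h1 : avg x = x i := by
      simp only [avg]
      rw [div_eq_iff hVt.ne', Finset.mul_sum]
      exact Finset.sum_congr rfl fun j _ => by rw [hconst j i, mul_comm]
    have h2 : avg x = 0 := by
      exact pow_eq_zero_iff two_ne_zero |>.1 ((mul_eq_zero.1 ha0).resolve_right hVt.ne')
    exact hi (by rw [← h1, h2]; rfl)
  · refine (hasDerivWithinAt_pi.2 fun i => hT i t ht).congr_deriv (funext fun i => ?_)
    have h1 := hT' i t ht
    simp only [A, Pi.add_apply]
    have := (N.V_pos i).ne'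
    field_simp
    linarith
  · refine tendsto_pi_nhds.2 fun i => ?_
    exact ((tendsto_pi_nhds.1 hb i).div_const _).add hθ

end CHPNetwork

/-! ### The two modes as passive networks -/

namespace CHPNetwork

variable {Ne Nh Eh : Type*} [Fintype Ne] [DecidableEq Ne] [Fintype Nh] [DecidableEq Nh]
  [Fintype Eh] [DecidableEq Eh] {N : CHPNetwork Ne Nh Eh}

section Derivatives

variable {x : ℝ → N.State} {v : N.State} {s : Set ℝ} {t : ℝ}

theorem hasDerivWithinAt_η (h : HasDerivWithinAt x v s t) (e : N.Ee) :
    HasDerivWithinAt (fun t => (x t).η e) (v.η e) s t :=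
  hasDerivWithinAt_pi.1 h.fst e

theorem hasDerivWithinAt_ω (h : HasDerivWithinAt x v s t) (j : Ne) :
    HasDerivWithinAt (fun t => (x t).ω j) (v.ω j) s t :=
  hasDerivWithinAt_pi.1 h.snd.fst j

theorem hasDerivWithinAt_pG (h : HasDerivWithinAt x v s t) (j : N.NeG) :
    HasDerivWithinAt (fun t => (x t).pG j) (v.pG j) s t :=
  hasDerivWithinAt_pi.1 h.snd.snd.fst j

theorem hasDerivWithinAt_T (h : HasDerivWithinAt x v s t) (i : Eh ⊕ Nh) :
    HasDerivWithinAt (fun t => (x t).T i) (v.T i) s t :=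
  hasDerivWithinAt_pi.1 h.snd.snd.snd.fst i

theorem hasDerivWithinAt_hG (h : HasDerivWithinAt x v s t) (e : N.EhG) :
    HasDerivWithinAt (fun t => (x t).hG e) (v.hG e) s t :=
  hasDerivWithinAt_pi.1 h.snd.snd.snd.snd e

theorem hasDerivWithinAt_avgTemp (h : HasDerivWithinAt x v s t) :
    HasDerivWithinAt (fun t => N.avgTemp (x t)) (N.avgTemp v) s t :=
  (HasDerivWithinAt.fun_sum fun i _ => (hasDerivWithinAt_T h i).const_mul (N.V i)).div_const _

end Derivatives

section Continuity

@[fun_prop]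
theorem continuous_η : Continuous fun x : N.State => x.η := by
  unfold State.η
  fun_prop

@[fun_prop]
theorem continuous_ω : Continuous fun x : N.State => x.ω := by
  unfold State.ω
  fun_prop

@[fun_prop]
theorem continuous_pG : Continuous fun x : N.State => x.pG := by
  unfold State.pG
  fun_prop

@[fun_prop]
theorem continuous_T : Continuous fun x : N.State => x.T := by
  unfold State.T
  fun_prop

@[fun_prop]
theorem continuous_hG : Continuous fun x : N.State => x.hG := by
  unfold State.hG
  fun_prop

@[fun_prop]
theorem continuous_avgTemp : Continuous N.avgTemp := by
  unfold avgTemp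
  fun_prop

@[fun_prop]
theorem continuous_netInflow (j : Ne) : Continuous fun x => N.netInflow x j := by
  unfold netInflow lineFlow
  refine .sub (continuous_finsetSum _ fun e _ => ?_) (continuous_finsetSum _ fun e _ => ?_) <;>
  split_ifs <;> fun_prop

end Continuity

variable (N)

/-- The heat injected into the heating network. -/
noncomputable def heatInput (hG : N.EhG → ℝ) (pP : N.He → ℝ) : Eh ⊕ Nh → ℝ :=
  Sum.elim (fun e => extendZero hG e + extendZero (N.hP pP) e - extendZero N.hL e) 0

variable {N}

theorem CommonEqs.heat {x v : N.State} {pP : N.He → ℝ} (h : N.CommonEqs x v pP) (i : Eh ⊕ Nh) :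
    N.V i * v.T i = N.heatFlow x.T i + N.heatInput x.hG pP i := by
  rcases i with e | k
  · rw [h.heatEdge e]
    simp only [heatFlow, heatInput, Sum.elim_inl]
    ring
  · rw [h.heatNode k]
    simp [heatFlow, heatInput]

theorem sum_heatInput (hG : N.EhG → ℝ) (pP : N.He → ℝ) : ∑ i, N.heatInput hG pP i =
    ∑ e, hG e + ∑ j, N.Co j * pP j - ∑ e, N.hL e := by
  rw [Fintype.sum_sum_type]
  simp only [heatInput, Sum.elim_inl, Sum.elim_inr, Finset.sum_sub_distrib,
    Finset.sum_add_distrib, sum_extendZero, hP, Pi.zero_apply, Finset.sum_const_zero, add_zero]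
  rw [Equiv.sum_comp N.pumpEdge.symm fun j => N.Co j * pP j]

/-- The internal heat flows sum to zero, so the total heat sees only the injections and the loads.
-/
theorem CommonEqs.avgTemp {x v : N.State} {pP : N.He → ℝ} (h : N.CommonEqs x v pP) :
    (∑ i, N.V i) * N.avgTemp v = ∑ e, x.hG e + (∑ j, N.Co j * pP j - ∑ e, N.hL e) := by
  rw [CHPNetwork.avgTemp, mul_div_cancel₀ _ N.sum_V_pos.ne']
  rw [Finset.sum_congr rfl fun i _ => h.heat i, Finset.sum_add_distrib, N.sum_heatFlow,
    sum_heatInput]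
  ring

theorem tendsto_heatInput {hG : ℝ → N.EhG → ℝ} {pP : ℝ → N.He → ℝ} {hG₀ : N.EhG → ℝ}
    {pP₀ : N.He → ℝ} (h1 : Tendsto hG atTop (𝓝 hG₀)) (h2 : Tendsto pP atTop (𝓝 pP₀)) :
    Tendsto (fun t => N.heatInput (hG t) (pP t)) atTop (𝓝 (N.heatInput hG₀ pP₀)) := by
  have hc : Continuous fun z : (N.EhG → ℝ) × (N.He → ℝ) => N.heatInput z.1 z.2 := by
    refine continuous_pi fun i => ?_
    rcases i with e | k
    · simp only [heatInput, Sum.elim_inl, extendZero_eq_sum, hP]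
      refine .sub (.add (continuous_finsetSum _ fun e _ => ?_)
        (continuous_finsetSum _ fun e _ => ?_)) continuous_const <;>
      split_ifs <;> fun_prop
    · simpa [heatInput] using continuous_const
  have := Tendsto.comp (hc.tendsto (hG₀, pP₀)) (h1.prodMk_nhds h2)
  exact this

/-- Incidence coefficient of a line and a bus. -/
def incidence (e : N.Ee) (j : Ne) : ℝ := (if e.1.1 = j then 1 else 0) - if e.1.2 = j then 1 else 0

theorem sum_incidence_mul (e : N.Ee) (w : Ne → ℝ) :
    ∑ j, incidence e j * w j = w e.1.1 - w e.1.2 := by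
  simp [incidence, sub_mul, Finset.sum_sub_distrib]

theorem netInflow_eq (x : N.State) (j : Ne) :
    N.netInflow x j = -∑ e, incidence e j * (N.B e * sin (x.η e)) := by
  rw [netInflow, ← Finset.sum_sub_distrib, ← Finset.sum_neg_distrib]
  refine Finset.sum_congr rfl fun e _ => ?_
  simp only [incidence, lineFlow]
  split_ifs <;> ring

theorem sum_coupling_left (pG : N.NeG → ℝ) (j : Ne) :
    ∑ g : N.NeG, (if (g : Ne) = j then (-1 : ℝ) else 0) * pG g = -extendZero pG j := by
  rw [extendZero_eq_sum, ← Finset.sum_neg_distrib]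
  exact Finset.sum_congr rfl fun g _ => by split_ifs <;> ring

variable (N)

/-- The electric network with frequency dependent heat pumps as a passive network. -/
noncomputable def passive₁ (a : N.He → ℝ) (ha : ∀ j, 0 < a j) :
    PassiveNetwork N.Ee (Ne ⊕ N.NeG) where
  B := N.B
  B_pos := N.B_pos
  Γ e := Sum.elim (fun j => incidence e j) 0
  -- The generator equation is multiplied by `Qe g`: its feedback then becomes `-ω`, the negative
  -- transpose of the term `+pG` in the swing equation, so `J` is skew.
  μ := Sum.elim N.M fun g => N.Qe g * N.τe g
  μ_nonneg := by
    rintro (j | g)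
    · exact N.M_nonneg j
    · exact (mul_pos (N.Qe_pos g) (N.τe_pos g)).le
  d := Sum.elim (fun j => N.D j + extendZero a j) N.Qe
  d_nonneg := by
    rintro (j | g)
    · exact add_nonneg (N.D_pos j).le (extendZero_nonneg (fun j => (ha j).le) j)
    · exact (N.Qe_pos g).le
  J := Sum.elim (fun j => Sum.elim 0 fun g => if (g : Ne) = j then -1 else 0)
    fun g => Sum.elim (fun j => if (g : Ne) = j then 1 else 0) 0
  J_skew := by
    rintro (j | g) (i | l)
    · simp
    · simp only [Sum.elim_inl, Sum.elim_inr]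
      split_ifs <;> simp
    · simp only [Sum.elim_inl, Sum.elim_inr]
      split_ifs <;> simp
    · simp
  c := Sum.elim (fun j => -N.pL j) 0
  d_pos := by
    rintro (j | g) h
    · exact add_pos_of_pos_of_nonneg (N.D_pos j) (extendZero_nonneg (fun j => (ha j).le) j)
    · exact N.Qe_pos g
  J_eq_zero := by
    rintro (j | g) (i | l) h h'
    · simp
    · exact absurd h' (mul_pos (N.Qe_pos l) (N.τe_pos l)).ne'
    · exact absurd h (mul_pos (N.Qe_pos g) (N.τe_pos g)).ne'
    · simp
  detect := by
    rintro (j | g) h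
    · exact absurd h (add_pos_of_pos_of_nonneg (N.D_pos j)
        (extendZero_nonneg (fun j => (ha j).le) j)).ne'
    · exact absurd h (N.Qe_pos g).ne'

variable {N}

/-- The frequencies and generated powers of a state. -/
def electric (x : N.State) : Ne ⊕ N.NeG → ℝ := Sum.elim x.ω x.pG

theorem passive₁_angle {a : N.He → ℝ} (ha : ∀ j, 0 < a j) (x : N.State) (e : N.Ee) :
    ∑ k, (N.passive₁ a ha).Γ e k * electric x k = x.ω e.1.1 - x.ω e.1.2 := by
  rw [Fintype.sum_sum_type]
  simp [passive₁, electric, sum_incidence_mul]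

theorem passive₁_force {a : N.He → ℝ} (ha : ∀ j, 0 < a j) {x v : N.State} (h : N.Mode1 a x v)
    (k : Ne ⊕ N.NeG) :
    (N.passive₁ a ha).μ k * electric v k = (N.passive₁ a ha).force x.η (electric x) k := by
  obtain ⟨pP, hc, hs, hp⟩ := h
  rw [PassiveNetwork.force, Fintype.sum_sum_type]
  rcases k with j | g
  · have h1 := hs j
    rw [Swing, netInflow_eq] at h1
    have h2 : extendZero pP j = extendZero a j * x.ω j := by
      unfold extendZero
      split_ifs with hj
      · exact hp _
      · ring
    simp only [passive₁, electric, Sum.elim_inl, Sum.elim_inr, Pi.zero_apply, zero_mul,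
      Finset.sum_const_zero, zero_add, sum_coupling_left]
    rw [h1, h2]
    ring
  · have h1 := hc.generator g
    have h2 := (N.Qe_pos g).ne'
    have h3 : N.Qe g * N.τe g * v.pG g = -(N.Qe g * x.pG g) - x.ω g := by
      rw [mul_assoc, h1]
      field_simp
    simp [passive₁, electric, h3]

theorem passive₁_isTrajectory {a : N.He → ℝ} (ha : ∀ j, 0 < a j) {x v : ℝ → N.State}
    (h : ∀ t, 0 ≤ t → HasDerivWithinAt x (v t) (Set.Ici 0) t ∧ N.Mode1 a (x t) (v t)) :
    (N.passive₁ a ha).IsTrajectory (fun t => (x t).η) (fun t => electric (x t))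
      fun t => electric (v t) where
  hasDeriv_angle e t ht := by
    have h1 := hasDerivWithinAt_η (h t ht).1 e
    obtain ⟨pP, hc, -⟩ := (h t ht).2
    rwa [hc.line e, ← passive₁_angle ha] at h1
  hasDeriv := by
    rintro (j | g) t ht
    · exact hasDerivWithinAt_ω (h t ht).1 j
    · exact hasDerivWithinAt_pG (h t ht).1 g
  force_eq k t ht := passive₁_force ha (h t ht).2 k

theorem passive₁_isRest {a : N.He → ℝ} (ha : ∀ j, 0 < a j) {x : N.State}
    (h : IsEquilibrium (N.Mode1 a) x) : (N.passive₁ a ha).IsRest x.η (electric x) where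
  angle e := by
    obtain ⟨pP, hc, -⟩ := h
    rw [passive₁_angle, ← hc.line e]
    rfl
  force_eq k := by
    rw [← passive₁_force ha h k]
    rcases k with j | g <;> simp [electric, State.ω, State.pG]

variable (N)

/-- The electric network together with the average temperature and the heat sources as a passive
network, for heat pumps acting as converter buses. -/
noncomputable def passive₂ (m : N.He → ℝ) {κ : ℝ} (hκ : 0 < κ) (hne : N.EhG.Nonempty) :
    PassiveNetwork N.Ee (Ne ⊕ N.NeG ⊕ Unit ⊕ N.EhG) where
  B := N.B
  B_pos := N.B_pos
  -- Converter buses keep a dummy variable, identically zero, massless and free of springs. Their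
  -- lines are attached to the average temperature instead, with weights `m j`.
  Γ e := Sum.elim (fun j => if j ∈ N.He then 0 else incidence e j) <| Sum.elim 0 <|
    Sum.elim (fun _ => ∑ j : N.He, m j * incidence e j) 0
  μ := Sum.elim (fun j => if j ∈ N.He then 0 else N.M j) <| Sum.elim (fun g => N.Qe g * N.τe g) <|
    Sum.elim (fun _ => κ * ∑ i, N.V i) fun e => κ * N.Qh e * N.τh e
  μ_nonneg := by
    rintro (j | g | u | e)
    · simp only [Sum.elim_inl]
      split_ifs
      exacts [le_rfl, N.M_nonneg j]
    · exact (mul_pos (N.Qe_pos g) (N.τe_pos g)).le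
    · exact (mul_pos hκ N.sum_V_pos).le
    · exact (mul_pos (mul_pos hκ (N.Qh_pos e)) (N.τh_pos e)).le
  d := Sum.elim N.D <| Sum.elim N.Qe <| Sum.elim 0 fun e => κ * N.Qh e
  d_nonneg := by
    rintro (j | g | u | e)
    · exact (N.D_pos j).le
    · exact (N.Qe_pos g).le
    · exact le_rfl
    · exact (mul_pos hκ (N.Qh_pos e)).le
  J := Sum.elim (fun j => Sum.elim 0 <| Sum.elim (fun g => if (g : Ne) = j then -1 else 0) 0) <|
    Sum.elim (fun g => Sum.elim (fun j => if (g : Ne) = j then 1 else 0) 0) <|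
    Sum.elim (fun _ => Sum.elim 0 <| Sum.elim 0 <| Sum.elim 0 fun _ => -κ)
      fun _ => Sum.elim 0 <| Sum.elim 0 <| Sum.elim (fun _ => κ) 0
  J_skew := by
    rintro (j | g | u | e) (i | l | u' | e') <;>
      simp only [Sum.elim_inl, Sum.elim_inr, Pi.zero_apply, neg_zero, neg_neg] <;>
      split_ifs <;> simp
  c := Sum.elim (fun j => if j ∈ N.He then 0 else -N.pL j) <| Sum.elim 0 <|
    Sum.elim (fun _ => -(κ * ∑ e, N.hL e)) 0
  d_pos := by
    rintro (j | g | u | e) h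
    · exact N.D_pos j
    · exact N.Qe_pos g
    · exact absurd h (mul_pos hκ N.sum_V_pos).ne'
    · exact mul_pos hκ (N.Qh_pos e)
  J_eq_zero := by
    rintro (j | g | u | e) k h h'
    · rcases k with i | g | u | e
      · rfl
      · exact absurd h' (mul_pos (N.Qe_pos g) (N.τe_pos g)).ne'
      · rfl
      · rfl
    · exact absurd h (mul_pos (N.Qe_pos g) (N.τe_pos g)).ne'
    · exact absurd h (mul_pos hκ N.sum_V_pos).ne'
    · exact absurd h (mul_pos (mul_pos hκ (N.Qh_pos e)) (N.τh_pos e)).ne'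
  detect := by
    rintro (j | g | u | e) h
    · exact absurd h (N.D_pos j).ne'
    · exact absurd h (N.Qe_pos g).ne'
    · obtain ⟨e, he⟩ := hne
      refine ⟨.inr (.inr (.inr ⟨e, he⟩)), fun _ => rfl, mul_pos hκ (N.Qh_pos _), hκ.ne', ?_⟩
      rintro (j | g | u' | e) hk h'
      · exact absurd h' (N.D_pos j).ne'
      · exact absurd h' (N.Qe_pos g).ne'
      · exact absurd rfl hk
      · exact absurd h' (mul_pos hκ (N.Qh_pos e)).ne'
    · exact absurd h (mul_pos hκ (N.Qh_pos e)).ne'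

variable {N}

/-- The passive variables of a state: frequencies of buses without heat pump, generated powers,
average temperature and heat source powers. -/
noncomputable def electroThermal (x : N.State) : Ne ⊕ N.NeG ⊕ Unit ⊕ N.EhG → ℝ :=
  Sum.elim (fun j => if j ∈ N.He then 0 else x.ω j) <| Sum.elim x.pG <|
    Sum.elim (fun _ => N.avgTemp x) x.hG

theorem sum_ite_mem_He (w : Ne → ℝ) :
    ∑ j, w j = ∑ j, (if j ∈ N.He then 0 else w j) + ∑ j : N.He, w j := by
  have h1 : ∑ j : N.He, w j = ∑ j, if j ∈ N.He then w j else 0 := by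
    rw [← Finset.sum_filter, Finset.filter_mem_eq_inter, Finset.univ_inter, Finset.sum_coe_sort]
  rw [h1, ← Finset.sum_add_distrib]
  exact Finset.sum_congr rfl fun j _ => by split_ifs <;> simp

theorem passive₂_angle {m : N.He → ℝ} {κ : ℝ} (hκ : 0 < κ) (hne : N.EhG.Nonempty)
    {x v : N.State} (h : N.Mode2 m x v) (e : N.Ee) :
    ∑ k, (N.passive₂ m hκ hne).Γ e k * electroThermal x k = v.η e := by
  obtain ⟨pP, hc, -, hp⟩ := h
  rw [hc.line e, ← sum_incidence_mul e x.ω, sum_ite_mem_He (N := N)]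
  simp only [Fintype.sum_sum_type, passive₂, electroThermal, Sum.elim_inl, Sum.elim_inr,
    Pi.zero_apply, zero_mul, Finset.sum_const_zero, zero_add, add_zero, Finset.univ_unique,
    Finset.sum_singleton]
  congr 1
  · exact Finset.sum_congr rfl fun j _ => by split_ifs <;> simp
  · rw [Finset.sum_mul]
    exact Finset.sum_congr rfl fun j _ => by rw [(hp j).2]; ring

/-- The heat balance is multiplied by `κ`. Since `κ * Co j = m j`, the pumps then contribute `∑ m j
* pP j`, and `pP j` is the net inflow at the converter bus; this is precisely the spring force on
the average temperature dictated by its column of `Γ`. The heat source equations are scaled by `κ *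
Qh` for skewness. -/
theorem passive₂_force {m : N.He → ℝ} {κ : ℝ} (hκ : 0 < κ) (hdisj : Disjoint N.NeG N.He)
    (hne : N.EhG.Nonempty) (hm : ∀ j, m j = κ * N.Co j) {x v : N.State} (h : N.Mode2 m x v)
    (k : Ne ⊕ N.NeG ⊕ Unit ⊕ N.EhG) :
    (N.passive₂ m hκ hne).μ k * electroThermal v k =
      (N.passive₂ m hκ hne).force x.η (electroThermal x) k := by
  obtain ⟨pP, hc, hs, hp⟩ := h
  rw [PassiveNetwork.force]
  rcases k with j | g | u | e
  · simp only [Fintype.sum_sum_type, passive₂, electroThermal, Sum.elim_inl, Sum.elim_inr,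
      Pi.zero_apply, zero_mul, Finset.sum_const_zero, zero_add, add_zero, sum_coupling_left]
    by_cases hj : j ∈ N.He
    -- Without this, a generator at a converter bus would exert a force on the dummy variable.
    · have h1 : j ∉ N.NeG := fun hG => Finset.disjoint_left.1 hdisj hG hj
      simp [hj, extendZero_of_notMem _ h1]
    · have h1 := hs j hj
      rw [Swing, netInflow_eq, extendZero_of_notMem _ hj] at h1
      simp only [hj, if_false]
      rw [h1]
      ring
  · have h1 := hc.generator g
    have h2 := (N.Qe_pos g).ne'
    have hg : (g : Ne) ∉ N.He := fun hG => Finset.disjoint_left.1 hdisj g.2 hG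
    have h3 : N.Qe g * N.τe g * v.pG g = -(N.Qe g * x.pG g) - x.ω g := by
      rw [mul_assoc, h1]
      field_simp
    simp only [Fintype.sum_sum_type, passive₂, electroThermal, Sum.elim_inl, Sum.elim_inr,
      Pi.zero_apply, zero_mul, Finset.sum_const_zero, add_zero, h3]
    have h4 : ∑ j, (if (g : Ne) = j then (1 : ℝ) else 0) * (if j ∈ N.He then 0 else x.ω j)
        = x.ω g := by
      simp only [ite_mul, one_mul, zero_mul, Finset.sum_ite_eq, Finset.mem_univ, if_true, hg,
        if_false]
    rw [h4]
    simp
  · have h1 := hc.avgTemp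
    have h2 : ∑ e, (∑ j : N.He, m j * incidence e (j : Ne)) * (N.B e * sin (x.η e))
        = -(κ * ∑ j, N.Co j * pP j) := by
      simp only [Finset.sum_mul]
      rw [Finset.sum_comm, Finset.mul_sum, ← Finset.sum_neg_distrib]
      refine Finset.sum_congr rfl fun j _ => ?_
      have h3 : pP j = N.netInflow x j := by linarith [(hp j).1]
      rw [h3, netInflow_eq, hm]
      simp only [mul_neg, neg_neg, Finset.mul_sum]
      exact Finset.sum_congr rfl fun e _ => by ring
    simp only [Fintype.sum_sum_type] at h1
    simp only [Fintype.sum_sum_type, passive₂, electroThermal, Sum.elim_inl, Sum.elim_inr,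
      Pi.zero_apply, zero_mul, Finset.sum_const_zero, zero_add, h2]
    rw [← Finset.mul_sum]
    linear_combination κ * h1
  · have h1 := hc.heatSource e
    have h2 := (N.Qh_pos e).ne'
    have h3 : κ * N.Qh e * N.τh e * v.hG e = -(κ * N.Qh e * x.hG e) - κ * N.avgTemp x := by
      rw [mul_assoc, h1]
      field_simp
    simp [passive₂, electroThermal, h3]

theorem passive₂_isTrajectory {m : N.He → ℝ} {κ : ℝ} (hκ : 0 < κ) (hdisj : Disjoint N.NeG N.He)
    (hne : N.EhG.Nonempty) (hm : ∀ j, m j = κ * N.Co j) {x v : ℝ → N.State}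
    (h : ∀ t, 0 ≤ t → HasDerivWithinAt x (v t) (Set.Ici 0) t ∧ N.Mode2 m (x t) (v t)) :
    (N.passive₂ m hκ hne).IsTrajectory (fun t => (x t).η) (fun t => electroThermal (x t))
      fun t => electroThermal (v t) where
  hasDeriv_angle e t ht := by
    rw [passive₂_angle hκ hne (h t ht).2]
    exact hasDerivWithinAt_η (h t ht).1 e
  hasDeriv := by
    rintro (j | g | u | e) t ht
    · by_cases hj : j ∈ N.He
      · simpa [electroThermal, hj] using hasDerivWithinAt_const t (Set.Ici 0) (0 : ℝ)
      · simpa [electroThermal, hj] using hasDerivWithinAt_ω (h t ht).1 j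
    · exact hasDerivWithinAt_pG (h t ht).1 g
    · exact hasDerivWithinAt_avgTemp (h t ht).1
    · exact hasDerivWithinAt_hG (h t ht).1 e
  force_eq k t ht := passive₂_force hκ hdisj hne hm (h t ht).2 k

theorem passive₂_isRest {m : N.He → ℝ} {κ : ℝ} (hκ : 0 < κ) (hdisj : Disjoint N.NeG N.He)
    (hne : N.EhG.Nonempty) (hm : ∀ j, m j = κ * N.Co j) {x : N.State}
    (h : IsEquilibrium (N.Mode2 m) x) :
    (N.passive₂ m hκ hne).IsRest x.η (electroThermal x) where
  angle e := by
    rw [passive₂_angle hκ hne h]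
    rfl
  force_eq k := by
    rw [← passive₂_force hκ hdisj hne hm h k]
    rcases k with j | g | u | e <;>
      simp [electroThermal, State.ω, State.pG, State.hG, State.T, CHPNetwork.avgTemp]

end CHPNetwork

/-! ### Global existence from consistent initial states -/

open scoped NNReal in
/-- Continuously differentiable and globally Lipschitz maps. -/
def SmoothLip {E F : Type*} [NormedAddCommGroup E] [NormedSpace ℝ E] [NormedAddCommGroup F]
    [NormedSpace ℝ F] (f : E → F) : Prop :=
  ContDiff ℝ 1 f ∧ ∃ K : ℝ≥0, LipschitzWith K f

namespace SmoothLip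

variable {E F G : Type*} [NormedAddCommGroup E] [NormedSpace ℝ E] [NormedAddCommGroup F]
  [NormedSpace ℝ F] [NormedAddCommGroup G] [NormedSpace ℝ G]

theorem comp {g : F → G} {f : E → F} (hg : SmoothLip g) (hf : SmoothLip f) :
    SmoothLip fun x => g (f x) := by
  obtain ⟨h1, K, h2⟩ := hg
  obtain ⟨h3, L, h4⟩ := hf
  exact ⟨h1.comp h3, K * L, h2.comp h4⟩

theorem const (c : F) : SmoothLip fun _ : E => c := ⟨contDiff_const, 0, LipschitzWith.const c⟩

theorem clm (f : E →L[ℝ] F) : SmoothLip f := ⟨f.contDiff, _, f.lipschitz⟩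

theorem id : SmoothLip fun x : E => x := ⟨contDiff_id, 1, LipschitzWith.id⟩

theorem fst {f : E → F × G} (hf : SmoothLip f) : SmoothLip fun x => (f x).1 :=
  (clm (ContinuousLinearMap.fst ℝ F G)).comp hf

theorem snd {f : E → F × G} (hf : SmoothLip f) : SmoothLip fun x => (f x).2 :=
  (clm (ContinuousLinearMap.snd ℝ F G)).comp hf

theorem add {f g : E → F} (hf : SmoothLip f) (hg : SmoothLip g) : SmoothLip fun x => f x + g x := by
  obtain ⟨h1, K, h2⟩ := hf
  obtain ⟨h3, L, h4⟩ := hg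
  exact ⟨h1.add h3, K + L, h2.add h4⟩

theorem sub {f g : E → F} (hf : SmoothLip f) (hg : SmoothLip g) : SmoothLip fun x => f x - g x := by
  obtain ⟨h1, K, h2⟩ := hf
  obtain ⟨h3, L, h4⟩ := hg
  exact ⟨h1.sub h3, K + L, h2.sub h4⟩

theorem neg {f : E → F} (hf : SmoothLip f) : SmoothLip fun x => -f x := by
  obtain ⟨h1, K, h2⟩ := hf
  exact ⟨h1.neg, K, h2.neg⟩

theorem const_mul {f : E → ℝ} (c : ℝ) (hf : SmoothLip f) : SmoothLip fun x => c * f x := by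
  have h : SmoothLip fun y : ℝ => c * y := clm (ContinuousLinearMap.mul ℝ ℝ c)
  exact h.comp hf

theorem div_const {f : E → ℝ} (hf : SmoothLip f) (c : ℝ) : SmoothLip fun x => f x / c := by
  simpa only [div_eq_inv_mul] using hf.const_mul c⁻¹

theorem sum {ι : Type*} (s : Finset ι) {f : ι → E → ℝ} (hf : ∀ i, SmoothLip (f i)) :
    SmoothLip fun x => ∑ i ∈ s, f i x := by
  classical
  induction s using Finset.induction_on with
  | empty => simpa using const (E := E) (0 : ℝ)
  | insert a s ha ih => simpa [Finset.sum_insert ha] using (hf a).add ih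

theorem sin {f : E → ℝ} (hf : SmoothLip f) : SmoothLip fun x => Real.sin (f x) :=
  comp ⟨Real.contDiff_sin, 1, Real.lipschitzWith_sin⟩ hf

theorem ite {f g : E → ℝ} {p : Prop} [Decidable p] (hf : SmoothLip f) (hg : SmoothLip g) :
    SmoothLip fun x => if p then f x else g x := by
  split_ifs
  exacts [hf, hg]

theorem prodMk {f : E → F} {g : E → G} (hf : SmoothLip f) (hg : SmoothLip g) :
    SmoothLip fun x => (f x, g x) := by
  obtain ⟨h1, K, h2⟩ := hf
  obtain ⟨h3, L, h4⟩ := hg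
  exact ⟨h1.prodMk h3, max K L, h2.prodMk h4⟩

theorem pi {ι : Type*} [Fintype ι] {f : E → ι → ℝ} (hf : ∀ i, SmoothLip fun x => f x i) :
    SmoothLip f := by
  choose h1 K h2 using hf
  refine ⟨contDiff_pi.2 h1, ∑ i, K i, LipschitzWith.of_dist_le_mul fun x y => ?_⟩
  rw [dist_pi_le_iff (by positivity)]
  intro i
  refine ((h2 i).dist_le_mul x y).trans ?_
  refine mul_le_mul_of_nonneg_right ?_ dist_nonneg
  exact_mod_cast Finset.single_le_sum (f := K) (fun i _ => (K i).2) (Finset.mem_univ i)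

theorem apply {ι : Type*} [Fintype ι] {f : E → ι → ℝ} (hf : SmoothLip f) (i : ι) :
    SmoothLip fun x => f x i :=
  (clm (ContinuousLinearMap.proj (R := ℝ) (φ := fun _ : ι => ℝ) i)).comp hf

theorem extendZero {ι : Type*} [DecidableEq ι] {s : Finset ι} {f : E → s → ℝ} (hf : SmoothLip f)
    (i : ι) : SmoothLip fun x => _root_.extendZero (f x) i := by
  unfold _root_.extendZero
  split_ifs
  exacts [hf.apply _, const 0]

end SmoothLip

namespace CHPNetwork

variable {Ne Nh Eh : Type*} [Fintype Ne] [DecidableEq Ne] [Fintype Nh] [DecidableEq Nh]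
  [Fintype Eh] [DecidableEq Eh] {N : CHPNetwork Ne Nh Eh}

theorem smoothLip_η : SmoothLip fun x : N.State => x.η := SmoothLip.id.fst

theorem smoothLip_ω : SmoothLip fun x : N.State => x.ω := SmoothLip.id.snd.fst

theorem smoothLip_pG : SmoothLip fun x : N.State => x.pG := SmoothLip.id.snd.snd.fst

theorem smoothLip_T : SmoothLip fun x : N.State => x.T := SmoothLip.id.snd.snd.snd.fst

theorem smoothLip_hG : SmoothLip fun x : N.State => x.hG := SmoothLip.id.snd.snd.snd.snd

theorem smoothLip_avgTemp : SmoothLip N.avgTemp :=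
  (SmoothLip.sum _ fun i => (smoothLip_T.apply i).const_mul _).div_const _

theorem smoothLip_netInflow (j : Ne) : SmoothLip fun x => N.netInflow x j := by
  simp only [netInflow_eq]
  exact (SmoothLip.sum _ fun e => ((smoothLip_η.apply e).sin.const_mul _).const_mul _).neg

theorem smoothLip_heatFlow : SmoothLip fun x : N.State => N.heatFlow x.T :=
  (SmoothLip.clm (LinearMap.toContinuousLinearMap N.isLinearMap_heatFlow.mk')).comp smoothLip_T

theorem smoothLip_heatInput {P : N.State → N.He → ℝ} (hP : SmoothLip P) :
    SmoothLip fun x : N.State => N.heatInput x.hG (P x) := by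
  refine SmoothLip.pi fun i => ?_
  rcases i with e | k
  · simp only [heatInput, Sum.elim_inl]
    refine ((smoothLip_hG.extendZero e).add (SmoothLip.extendZero ?_ e)).sub (SmoothLip.const _)
    exact SmoothLip.pi fun e => (hP.apply _).const_mul _
  · exact SmoothLip.const 0

/-- Replace the frequencies of a state. -/
def State.setω (y : N.State) (w : Ne → ℝ) : N.State := (y.1, w, y.2.2)

/-- The reduced vector field, in which the frequencies are given by `Ω` and the pump powers
by `P`. -/
noncomputable def reducedField (Ω : N.State → Ne → ℝ) (P : N.State → N.He → ℝ) (dyn : Finset Ne)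
    (y : N.State) : N.State :=
  (fun e => Ω y e.1.1 - Ω y e.1.2,
    -- Frequencies outside `dyn` are given algebraically by `Ω`, so their slot in the reduced state
    -- is frozen and later overwritten by `setω`.
    fun j => if j ∈ dyn then (-N.pL j - extendZero (P y) j + extendZero y.pG j - N.D j * Ω y j
      + N.netInflow y j) / N.M j else 0,
    fun g => (-y.pG g - 1 / N.Qe g * Ω y g) / N.τe g,
    fun i => (N.heatFlow y.T i + N.heatInput y.hG (P y) i) / N.V i,
    fun e => (-y.hG e - 1 / N.Qh e * N.avgTemp y) / N.τh e)

theorem smoothLip_reducedField {Ω : N.State → Ne → ℝ} {P : N.State → N.He → ℝ}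
    (hΩ : SmoothLip Ω) (hP : SmoothLip P) (dyn : Finset Ne) :
    SmoothLip (reducedField Ω P dyn) := by
  refine SmoothLip.prodMk (.pi fun e => ?_) (.prodMk (.pi fun j => ?_) (.prodMk (.pi fun g => ?_)
    (.prodMk (.pi fun i => ?_) (.pi fun e => ?_))))
  · exact (hΩ.apply _).sub (hΩ.apply _)
  · exact .ite ((((((SmoothLip.const _).sub (hP.extendZero j)).add
      (smoothLip_pG.extendZero j)).sub ((hΩ.apply j).const_mul _)).add
        (smoothLip_netInflow j)).div_const _) (.const 0)
  · exact ((smoothLip_pG.apply g).neg.sub ((hΩ.apply _).const_mul _)).div_const _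
  · exact ((smoothLip_heatFlow.apply i).add ((smoothLip_heatInput hP).apply i)).div_const _
  · exact ((smoothLip_hG.apply e).neg.sub (smoothLip_avgTemp.const_mul _)).div_const _

/-- Solutions of the reduced system give global solutions of all differential equations. -/
theorem exists_reduced_solution {Ω : N.State → Ne → ℝ} {P : N.State → N.He → ℝ}
    (hΩ : SmoothLip Ω) (hP : SmoothLip P) {dyn : Finset Ne} (hM : ∀ j ∈ dyn, N.M j ≠ 0)
    (hdyn : ∀ j ∈ dyn, ∀ y, Ω y j = y.ω j) (y₀ : N.State) :
    ∃ (y v : ℝ → N.State), y 0 = y₀ ∧ ∀ t,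
      HasDerivAt (fun t => (y t).setω (Ω (y t))) (v t) t ∧
      N.CommonEqs ((y t).setω (Ω (y t))) (v t) (P (y t)) ∧
      ∀ j ∈ dyn, N.Swing ((y t).setω (Ω (y t))) (v t) (P (y t)) j := by
  obtain ⟨hC, K, hK⟩ := smoothLip_reducedField hΩ hP dyn
  obtain ⟨y, hy0, hy⟩ := exists_forall_hasDerivAt_of_lipschitzWith hK hC y₀
  -- The algebraic frequencies are differentiable along the curve because `Ω` is `C¹`, so they too
  -- have a genuine time derivative.
  let w : ℝ → Ne → ℝ := fun t j => if j ∈ dyn then (reducedField Ω P dyn (y t)).ω j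
    else deriv (fun t => Ω (y t) j) t
  refine ⟨y, fun t => (reducedField Ω P dyn (y t)).setω (w t), hy0, fun t => ⟨?_, ?_, ?_⟩⟩
  · refine HasDerivAt.prodMk (hy t).fst (HasDerivAt.prodMk (hasDerivAt_pi.2 fun j => ?_)
      (hy t).snd.snd)
    by_cases hj : j ∈ dyn
    · simp only [w, hj, if_true, hdyn j hj]
      exact hasDerivAt_pi.1 (hy t).snd.fst j
    · simp only [w, hj, if_false]
      have hd : DifferentiableAt ℝ (fun y => Ω y j) (y t) :=
        ((hΩ.apply j).1.differentiable one_ne_zero) _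
      exact (hd.comp t (hy t).differentiableAt).hasDerivAt
  · constructor
    · exact fun e => rfl
    · exact fun g => mul_div_cancel₀ _ (N.τe_pos g).ne'
    · intro e
      refine (mul_div_cancel₀ _ (N.V_pos (.inl e)).ne').trans ?_
      simp only [heatFlow, heatInput, Sum.elim_inl]
      rw [add_sub_assoc, add_sub_assoc, add_assoc]
      rfl
    · intro k
      refine (mul_div_cancel₀ _ (N.V_pos (.inr k)).ne').trans ?_
      simp only [heatFlow, heatInput, Sum.elim_inr, Pi.zero_apply, add_zero]
      rfl
    · exact fun e => mul_div_cancel₀ _ (N.τh_pos e).ne'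
  · intro j hj
    have h1 : N.M j * w t j = -N.pL j - extendZero (P (y t)) j + extendZero (y t).pG j
        - N.D j * Ω (y t) j + N.netInflow (y t) j := by
      simp only [w, hj, if_true]
      refine Eq.trans (congrArg _ (if_pos hj)) ?_
      exact mul_div_cancel₀ _ (hM j hj)
    exact h1

theorem isSolution_of_reduced {F : N.State → N.State → Prop} {Ω : N.State → Ne → ℝ}
    {y v : ℝ → N.State}
    (h : ∀ t, HasDerivAt (fun t => (y t).setω (Ω (y t))) (v t) t ∧
      F ((y t).setω (Ω (y t))) (v t)) : IsSolution F fun t => (y t).setω (Ω (y t)) :=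
  ⟨v, fun t _ => ⟨(h t).1.hasDerivWithinAt, (h t).2⟩⟩

/-- Global existence for frequency dependent heat pumps. -/
theorem exists_isSolution_mode1 {a : N.He → ℝ} (ha : ∀ j, 0 < a j) {x₀ v₀ : N.State}
    (h₀ : N.Mode1 a x₀ v₀) : ∃ x, IsSolution (N.Mode1 a) x ∧ x 0 = x₀ := by
  have hpos : ∀ j, N.D j + extendZero a j ≠ 0 := fun j => by
    exact (add_pos_of_pos_of_nonneg (N.D_pos j) (extendZero_nonneg (fun j => (ha j).le) j)).ne'
  have hext : ∀ (w : Ne → ℝ) j, extendZero (fun j : N.He => a j * w j) j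
      = extendZero a j * w j := fun w j => by
    unfold extendZero
    split_ifs <;> simp
  -- At a bus without inertia the swing equation is solved for the frequency, with the pump
  -- consumption counted as damping.
  let Ω : N.State → Ne → ℝ := fun y j => if N.M j = 0 then
    (-N.pL j + extendZero y.pG j + N.netInflow y j) / (N.D j + extendZero a j) else y.ω j
  have hΩ : SmoothLip Ω := .pi fun j => .ite ((((SmoothLip.const _).add
    (smoothLip_pG.extendZero j)).add (smoothLip_netInflow j)).div_const _) (smoothLip_ω.apply j)
  let P : N.State → N.He → ℝ := fun y j => a j * Ω y j
  have hP : SmoothLip P := .pi fun j => (hΩ.apply _).const_mul _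
  obtain ⟨y, v, hy0, hy⟩ := exists_reduced_solution hΩ hP
    (dyn := Finset.univ.filter fun j => N.M j ≠ 0) (by simp) (by simp +contextual [Ω]) x₀
  refine ⟨fun t => (y t).setω (Ω (y t)), isSolution_of_reduced (v := v) fun t => ⟨(hy t).1, ?_⟩, ?_⟩
  · refine ⟨P (y t), (hy t).2.1, fun j => ?_, fun j => rfl⟩
    by_cases hj : N.M j = 0
    · have h1 : (N.D j + extendZero a j) * Ω (y t) j
          = -N.pL j + extendZero (y t).pG j + N.netInflow (y t) j := by
        simp only [Ω, hj, if_true]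
        exact mul_div_cancel₀ _ (hpos j)
      have h2 : 0 = -N.pL j - extendZero (P (y t)) j + extendZero (y t).pG j
          - N.D j * Ω (y t) j + N.netInflow (y t) j := by
        rw [hext]
        linarith
      rw [Swing, hj, zero_mul]
      exact h2
    · exact (hy t).2.2 j (by simp [hj])
  -- Consistency of the initial state: its frequencies already satisfy the algebraic equations that
  -- define `Ω`.
  · have h1 : Ω x₀ = x₀.ω := by
      ext j
      by_cases hj : N.M j = 0
      · obtain ⟨pP, -, hs, hp⟩ := h₀
        have h2 := hs j
        have h3 : pP = fun j : N.He => a j * x₀.ω j := funext hp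
        rw [Swing, hj, zero_mul, h3, hext] at h2
        simp only [Ω, hj, if_true]
        rw [div_eq_iff (hpos j)]
        linarith
      · simp [Ω, hj]
    simp only [hy0, h1]
    rfl

/-- Global existence for heat pumps acting as converter buses. -/
theorem exists_isSolution_mode2 {m : N.He → ℝ} {x₀ v₀ : N.State}
    (h₀ : N.Mode2 m x₀ v₀) : ∃ x, IsSolution (N.Mode2 m) x ∧ x 0 = x₀ := by
  let Ω : N.State → Ne → ℝ := fun y j => if j ∈ N.He then extendZero m j * N.avgTemp y
    else if N.M j = 0 then (-N.pL j + extendZero y.pG j + N.netInflow y j) / N.D j else y.ω j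
  have hΩ : SmoothLip Ω := .pi fun j => .ite (smoothLip_avgTemp.const_mul _)
    (.ite ((((SmoothLip.const _).add (smoothLip_pG.extendZero j)).add
      (smoothLip_netInflow j)).div_const _) (smoothLip_ω.apply j))
  let P : N.State → N.He → ℝ := fun y j => N.netInflow y j
  have hP : SmoothLip P := .pi fun j => smoothLip_netInflow _
  obtain ⟨y, v, hy0, hy⟩ := exists_reduced_solution hΩ hP
    (dyn := Finset.univ.filter fun j => j ∉ N.He ∧ N.M j ≠ 0) (by simp +contextual)
    (by simp +contextual [Ω]) x₀
  refine ⟨fun t => (y t).setω (Ω (y t)), isSolution_of_reduced (v := v) fun t => ⟨(hy t).1, ?_⟩, ?_⟩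
  · refine ⟨P (y t), (hy t).2.1, fun j hj => ?_, fun j => ⟨(neg_add_cancel _).symm, ?_⟩⟩
    · by_cases hMj : N.M j = 0
      · have h1 : N.D j * Ω (y t) j
            = -N.pL j + extendZero (y t).pG j + N.netInflow (y t) j := by
          simp only [Ω, hj, hMj, if_true, if_false]
          exact mul_div_cancel₀ _ (N.D_pos j).ne'
        have h2 : 0 = -N.pL j - extendZero (P (y t)) j + extendZero (y t).pG j
            - N.D j * Ω (y t) j + N.netInflow (y t) j := by
          rw [extendZero_of_notMem _ hj]
          linarith
        rw [Swing, hMj, zero_mul]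
        exact h2
      · exact (hy t).2.2 j (by simp [hj, hMj])
    · have h1 : Ω (y t) j = m j * N.avgTemp (y t) := by
        simp only [Ω, j.2, if_true, extendZero_of_mem]
      exact h1
  · have h1 : Ω x₀ = x₀.ω := by
      obtain ⟨pP, -, hs, hp⟩ := h₀
      ext j
      by_cases hj : j ∈ N.He
      · simp only [Ω, hj, if_true]
        rw [(hp ⟨j, hj⟩).2, ← extendZero_of_mem m ⟨j, hj⟩]
      · by_cases hMj : N.M j = 0
        · have h2 := hs j hj
          rw [Swing, hMj, zero_mul, extendZero_of_notMem _ hj] at h2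
          simp only [Ω, hj, hMj, if_true, if_false]
          rw [div_eq_iff (N.D_pos j).ne']
          linarith
        · simp [Ω, hj, hMj]
    simp only [hy0, h1]
    rfl

end CHPNetwork

/-! ### Convergent integrals of the deviations -/

namespace PassiveNetwork

variable {E K : Type*} [Fintype E] [Fintype K] {P : PassiveNetwork E K} {η₀ : E → ℝ} {u₀ : K → ℝ}
  {η : ℝ → E → ℝ} {u u' : ℝ → K → ℝ}

/-- Along a convergent trajectory of a fully damped network, all linear combinations of the
deviations from the rest point have convergent antiderivatives. -/
theorem exists_tendsto_antideriv (ht : P.IsTrajectory η u u') (h : P.IsRest η₀ u₀)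
    (hd : ∀ k, 0 < P.d k) {η₁ : E → ℝ} (hη : Tendsto η atTop (𝓝 η₁))
    (hu : Tendsto u atTop (𝓝 u₀)) (c : K → ℝ) :
    ∃ (g : ℝ → ℝ) (l : ℝ), (∀ t, 0 ≤ t →
      HasDerivWithinAt g (∑ k, c k * (u t k - u₀ k)) (Set.Ici 0) t) ∧ Tendsto g atTop (𝓝 l) := by
  classical
  let S : Submodule ℝ (K → ℝ) :=
    { carrier := {c | ∃ (g : ℝ → ℝ) (l : ℝ), (∀ t, 0 ≤ t →
        HasDerivWithinAt g (∑ k, c k * (u t k - u₀ k)) (Set.Ici 0) t) ∧ Tendsto g atTop (𝓝 l)}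
      add_mem' := by
        rintro a b ⟨g, l, hg, hl⟩ ⟨g', l', hg', hl'⟩
        refine ⟨fun t => g t + g' t, l + l', fun t h0 => ?_, hl.add hl'⟩
        refine ((hg t h0).add (hg' t h0)).congr_deriv ?_
        simp only [Pi.add_apply, add_mul, Finset.sum_add_distrib]
      zero_mem' := ⟨fun _ => 0, 0, fun t _ => by
        simpa using hasDerivWithinAt_const t (Set.Ici 0) (0 : ℝ), tendsto_const_nhds⟩
      smul_mem' := by
        rintro r a ⟨g, l, hg, hl⟩
        refine ⟨fun t => r * g t, r * l, fun t h0 => ?_, hl.const_mul r⟩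
        refine ((hg t h0).const_mul r).congr_deriv ?_
        simp only [Pi.smul_apply, smul_eq_mul, Finset.mul_sum, mul_assoc] }
  suffices hS : S = ⊤ by
    have : c ∈ S := hS ▸ Submodule.mem_top
    exact this
  by_contra hne
  -- Duality: if the admissible coefficients formed a proper subspace, a nonzero vector `w` would
  -- annihilate them. The rows of `Γ` are admissible, with the angles as antiderivatives, so `Γ w =
  -- 0`.
  obtain ⟨f, hf0, hf⟩ := S.exists_le_ker_of_lt_top (lt_top_iff_ne_top.2 hne)
  let w : K → ℝ := fun k => f (Pi.single k 1)
  have hfw : ∀ c, f c = ∑ k, c k * w k := fun c => by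
    rw [LinearMap.pi_apply_eq_sum_univ f c]
    refine Finset.sum_congr rfl fun k _ => ?_
    simp only [smul_eq_mul, w]
    congr 2
    ext i
    simp [Pi.single_apply, eq_comm]
  have hΓ : ∀ e, ∑ k, P.Γ e k * w k = 0 := by
    intro e
    rw [← hfw]
    refine hf ⟨fun t => η t e, η₁ e, fun t h0 => ?_, tendsto_pi_nhds.1 hη e⟩
    refine (ht.hasDeriv_angle e t h0).congr_deriv ?_
    simp only [mul_sub, Finset.sum_sub_distrib, h.angle e, sub_zero]
  -- Pairing the force equations with `w` removes the springs, so this combination integrates to `-∑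
  -- w μ u`, which converges. Evaluating `w` on it gives `∑ d w² = 0`, as `J` is skew, and therefore
  -- `w = 0`.
  have hmem : (fun l => P.d l * w l + ∑ k, w k * P.J k l) ∈ S := by
    refine ⟨fun t => -∑ k, w k * (P.μ k * u t k), -∑ k, w k * (P.μ k * u₀ k), fun t h0 => ?_, ?_⟩
    · have h1 : HasDerivWithinAt (fun t => -∑ k, w k * (P.μ k * u t k))
          (-∑ k, w k * (P.μ k * u' t k)) (Set.Ici 0) t :=
        (HasDerivWithinAt.fun_sum fun k _ =>
          ((ht.hasDeriv k t h0).const_mul _).const_mul _).neg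
      refine h1.congr_deriv ?_
      have h2 : ∑ k, w k * ∑ e, P.Γ e k * (P.B e * (sin (η t e) - sin (η₀ e))) = 0 := by
        simp only [Finset.mul_sum]
        rw [Finset.sum_comm]
        refine Finset.sum_eq_zero fun e _ => ?_
        have : ∀ k, w k * (P.Γ e k * (P.B e * (sin (η t e) - sin (η₀ e))))
            = P.Γ e k * w k * (P.B e * (sin (η t e) - sin (η₀ e))) := fun k => by ring
        simp only [this]
        rw [← Finset.sum_mul, hΓ, zero_mul]
      have h3 : ∑ l, (∑ k, w k * P.J k l) * (u t l - u₀ l)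
          = ∑ k, w k * ∑ l, P.J k l * (u t l - u₀ l) := by
        simp only [Finset.mul_sum, Finset.sum_mul]
        rw [Finset.sum_comm]
        simp only [mul_assoc]
      have h4 : ∑ k, w k * (P.μ k * u' t k) =
          -(∑ k, w k * ∑ e, P.Γ e k * (P.B e * (sin (η t e) - sin (η₀ e))))
          - ∑ k, P.d k * w k * (u t k - u₀ k) - ∑ k, w k * ∑ l, P.J k l * (u t l - u₀ l) := by
        rw [← Finset.sum_neg_distrib, ← Finset.sum_sub_distrib, ← Finset.sum_sub_distrib]
        refine Finset.sum_congr rfl fun k _ => ?_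
        rw [ht.force_eq k t h0, h.force_sub]
        ring
      simp only [add_mul, Finset.sum_add_distrib]
      rw [h4, h2, h3]
      ring
    · exact (tendsto_finsetSum _ fun k _ =>
        ((tendsto_pi_nhds.1 hu k).const_mul _).const_mul _).neg
  have h1 := hf hmem
  rw [LinearMap.mem_ker, hfw] at h1
  have h2 : ∑ l, (P.d l * w l + ∑ k, w k * P.J k l) * w l
      = ∑ l, P.d l * w l ^ 2 + ∑ k, w k * ∑ l, P.J k l * w l := by
    have h3 : ∑ l, (∑ k, w k * P.J k l) * w l = ∑ k, w k * ∑ l, P.J k l * w l := by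
      simp only [Finset.mul_sum, Finset.sum_mul]
      rw [Finset.sum_comm]
      simp only [mul_assoc]
    rw [← h3, ← Finset.sum_add_distrib]
    exact Finset.sum_congr rfl fun l _ => by ring
  rw [h2, P.sum_skew_eq_zero, add_zero] at h1
  have hw : ∀ k, w k = 0 := fun k => by
    have := (Finset.sum_eq_zero_iff_of_nonneg fun l _ =>
      mul_nonneg (hd l).le (sq_nonneg (w l))).1 h1 k (Finset.mem_univ k)
    exact pow_eq_zero_iff two_ne_zero |>.1 ((mul_eq_zero.1 this).resolve_left (hd k).ne')
  refine hf0 (LinearMap.ext fun c => ?_)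
  simp [hfw, hw]

end PassiveNetwork

/-! ### Limits of solutions and local convergence -/

namespace CHPNetwork

variable {Ne Nh Eh : Type*} [Fintype Ne] [DecidableEq Ne] [Fintype Nh] [DecidableEq Nh]
  [Fintype Eh] [DecidableEq Eh] {N : CHPNetwork Ne Nh Eh}

section Limit

variable {x v : ℝ → N.State} {pP : ℝ → N.He → ℝ} {x₁ : N.State} {pP₁ : N.He → ℝ}

/-- The right-hand side `r` is the derivative of the convergent function `c * g`. The case `c = 0`,
an algebraic equation, is included. -/
theorem limit_rhs_eq_zero {g g' r : ℝ → ℝ} {c l m : ℝ}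
    (hg : ∀ t, 0 ≤ t → HasDerivWithinAt g (g' t) (Set.Ici 0) t)
    (hr : ∀ t, 0 ≤ t → c * g' t = r t) (hlim : Tendsto g atTop (𝓝 l))
    (hlim' : Tendsto r atTop (𝓝 m)) : m = 0 :=
  eq_zero_of_tendsto_of_tendsto_deriv (g := fun t => c * g t) (g' := r)
    (fun t ht => by rw [← hr t ht]; exact (hg t ht).const_mul c) (hlim.const_mul c) hlim'

theorem continuous_extendZero {ι : Type*} [DecidableEq ι] {s : Finset ι} (i : ι) :
    Continuous fun f : s → ℝ => extendZero f i := by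
  unfold extendZero
  split_ifs <;> fun_prop

/-- The limit of a solution satisfies the common equations with zero derivative. -/
theorem commonEqs_of_tendsto (hx : ∀ t, 0 ≤ t → HasDerivWithinAt x (v t) (Set.Ici 0) t)
    (hc : ∀ t, 0 ≤ t → N.CommonEqs (x t) (v t) (pP t)) (hlim : Tendsto x atTop (𝓝 x₁))
    (hP : Tendsto pP atTop (𝓝 pP₁)) : N.CommonEqs x₁ 0 pP₁ := by
  have hη := (continuous_η.tendsto x₁).comp hlim
  have hω := (continuous_ω.tendsto x₁).comp hlim
  have hpG := (continuous_pG.tendsto x₁).comp hlim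
  have hT := (continuous_T.tendsto x₁).comp hlim
  have hhG := (continuous_hG.tendsto x₁).comp hlim
  have havg := (continuous_avgTemp.tendsto x₁).comp hlim
  have hheat : ∀ i, N.heatFlow x₁.T i + N.heatInput x₁.hG pP₁ i = 0 := fun i => by
    refine limit_rhs_eq_zero (fun t ht => hasDerivWithinAt_T (hx t ht) i)
      (fun t ht => (hc t ht).heat i) (tendsto_pi_nhds.1 hT i) ?_
    have h1 := (smoothLip_heatFlow (N := N)).1.continuous.tendsto x₁ |>.comp hlim
    have h2 := tendsto_heatInput hhG hP
    exact (tendsto_pi_nhds.1 h1 i).add (tendsto_pi_nhds.1 h2 i)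
  have hz : ∀ i, (0 : N.State).T i = 0 := fun _ => rfl
  constructor
  · intro e
    refine Eq.trans rfl (limit_rhs_eq_zero (c := 1)
      (fun t ht => hasDerivWithinAt_η (hx t ht) e)
      (fun t ht => by rw [one_mul, (hc t ht).line e]; rfl) (tendsto_pi_nhds.1 hη e)
      ((tendsto_pi_nhds.1 hω _).sub (tendsto_pi_nhds.1 hω _))).symm
  · intro g
    refine Eq.trans (mul_zero _) (limit_rhs_eq_zero
      (fun t ht => hasDerivWithinAt_pG (hx t ht) g)
      (fun t ht => (hc t ht).generator g) (tendsto_pi_nhds.1 hpG g)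
      ((tendsto_pi_nhds.1 hpG _).neg.sub ((tendsto_pi_nhds.1 hω _).const_mul _))).symm
  · intro e
    have h1 := hheat (.inl e)
    simp only [heatFlow, heatInput, Sum.elim_inl] at h1
    rw [hz, mul_zero]
    linarith
  · intro k
    have h1 := hheat (.inr k)
    simp only [heatFlow, heatInput, Sum.elim_inr, Pi.zero_apply, add_zero] at h1
    rw [hz, mul_zero]
    exact h1.symm
  · intro e
    refine Eq.trans (mul_zero _) (limit_rhs_eq_zero
      (fun t ht => hasDerivWithinAt_hG (hx t ht) e)
      (fun t ht => (hc t ht).heatSource e) (tendsto_pi_nhds.1 hhG e)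
      ((tendsto_pi_nhds.1 hhG _).neg.sub (havg.const_mul _))).symm

/-- The limit of a solution satisfies the swing equations with zero derivative. -/
theorem swing_of_tendsto (hx : ∀ t, 0 ≤ t → HasDerivWithinAt x (v t) (Set.Ici 0) t) {j : Ne}
    (hs : ∀ t, 0 ≤ t → N.Swing (x t) (v t) (pP t) j) (hlim : Tendsto x atTop (𝓝 x₁))
    (hP : Tendsto pP atTop (𝓝 pP₁)) : N.Swing x₁ 0 pP₁ j := by
  have hω := tendsto_pi_nhds.1 ((continuous_ω.tendsto x₁).comp hlim) j
  have hpG := (continuous_pG.tendsto x₁).comp hlim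
  refine Eq.trans (mul_zero _) (limit_rhs_eq_zero
    (fun t ht => hasDerivWithinAt_ω (hx t ht) j) hs hω ?_).symm
  exact (((tendsto_const_nhds.sub (((continuous_extendZero j).tendsto pP₁).comp hP)).add
    (((continuous_extendZero j).tendsto _).comp hpG)).sub (hω.const_mul _)).add
    (((continuous_netInflow j).tendsto x₁).comp hlim)

/-- A solution converges to an equilibrium of the common equations once all variables but the
temperatures, and the average temperature, converge. -/
theorem exists_tendsto_state (hx : ∀ t, 0 ≤ t → HasDerivWithinAt x (v t) (Set.Ici 0) t)
    (hc : ∀ t, 0 ≤ t → N.CommonEqs (x t) (v t) (pP t)) {η₁ : N.Ee → ℝ} {ω₁ : Ne → ℝ}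
    {pG₁ : N.NeG → ℝ} {hG₁ : N.EhG → ℝ} {θ : ℝ}
    (hη : Tendsto (fun t => (x t).η) atTop (𝓝 η₁)) (hω : Tendsto (fun t => (x t).ω) atTop (𝓝 ω₁))
    (hpG : Tendsto (fun t => (x t).pG) atTop (𝓝 pG₁))
    (hhG : Tendsto (fun t => (x t).hG) atTop (𝓝 hG₁))
    (hθ : Tendsto (fun t => N.avgTemp (x t)) atTop (𝓝 θ)) (hP : Tendsto pP atTop (𝓝 pP₁)) :
    ∃ x₁, Tendsto x atTop (𝓝 x₁) ∧ N.CommonEqs x₁ 0 pP₁ := by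
  obtain ⟨T₁, hT⟩ := N.exists_tendsto_temperature (T := fun t => (x t).T) (T' := fun t => (v t).T)
    (b := fun t => N.heatInput (x t).hG (pP t))
    (fun i t ht => hasDerivWithinAt_T (hx t ht) i) (fun i t ht => (hc t ht).heat i)
    (tendsto_heatInput hhG hP) hθ
  have hlim : Tendsto x atTop (𝓝 (η₁, ω₁, pG₁, T₁, hG₁)) :=
    hη.prodMk_nhds (hω.prodMk_nhds (hpG.prodMk_nhds (hT.prodMk_nhds hhG)))
  exact ⟨_, hlim, commonEqs_of_tendsto hx hc hlim hP⟩

end Limit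

/-- With frequency dependent heat pumps, average temperature and heat sources converge once the
electric network does. -/
theorem exists_tendsto_avgTemp_mode1 {a : N.He → ℝ} (ha : ∀ j, 0 < a j) {xs : N.State}
    (hxs : IsEquilibrium (N.Mode1 a) xs) {x v : ℝ → N.State}
    (h : ∀ t, 0 ≤ t → HasDerivWithinAt x (v t) (Set.Ici 0) t ∧ N.Mode1 a (x t) (v t))
    (hc : ∀ t, 0 ≤ t → N.CommonEqs (x t) (v t) fun j => a j * (x t).ω j) {η₁ : N.Ee → ℝ}
    (hη : Tendsto (fun t => (x t).η) atTop (𝓝 η₁))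
    (hu : Tendsto (fun t => electric (x t)) atTop (𝓝 (electric xs))) :
    ∃ z : ℝ × (N.EhG → ℝ), Tendsto (fun t => N.avgTemp (x t)) atTop (𝓝 z.1) ∧
      Tendsto (fun t => (x t).hG) atTop (𝓝 z.2) := by
  have hω : ∀ j, Tendsto (fun t => (x t).ω j) atTop (𝓝 (xs.ω j)) := fun j =>
    tendsto_pi_nhds.1 hu (.inl j)
  rcases isEmpty_or_nonempty N.EhG with hE | hE
  -- Without sources nothing regulates the average temperature. The equilibrium balances pumps and
  -- loads, so its derivative is a combination of frequency deviations, with coefficients `Co j * a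
  -- j` up to the total volume, and its limit depends on the initial state.
  · obtain ⟨g, l, hg, hl⟩ := PassiveNetwork.exists_tendsto_antideriv
      (passive₁_isTrajectory ha h) (passive₁_isRest ha hxs) (by
        rintro (j | g)
        · exact add_pos_of_pos_of_nonneg (N.D_pos j) (extendZero_nonneg (fun j => (ha j).le) j)
        · exact N.Qe_pos g) hη hu
      (Sum.elim (extendZero fun j => N.Co j * a j) 0)
    have hsum : ∀ w : Ne → ℝ, ∑ j, extendZero (fun j => N.Co j * a j) j * w j
        = ∑ j : N.He, N.Co j * (a j * w j) := fun w => by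
      rw [← sum_extendZero]
      refine Finset.sum_congr rfl fun j _ => ?_
      unfold extendZero
      split_ifs <;> ring
    have hs0 : ∑ j : N.He, N.Co j * (a j * xs.ω j) - ∑ e, N.hL e = 0 := by
      obtain ⟨pP, hce, -, hp⟩ := hxs
      have h1 := hce.avgTemp
      have h2 : N.avgTemp 0 = 0 := by simp [CHPNetwork.avgTemp, State.T]
      rw [h2, mul_zero, Finset.univ_eq_empty, Finset.sum_empty, zero_add] at h1
      simpa only [hp] using h1.symm
    have hconst : ∀ t, 0 ≤ t → (∑ i, N.V i) * N.avgTemp (x t) - g t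
        = (∑ i, N.V i) * N.avgTemp (x 0) - g 0 := by
      intro t ht
      rcases ht.eq_or_lt with rfl | hpos
      · rfl
      · obtain ⟨ξ, -, hξ⟩ := exists_slope_of_hasDerivWithinAt_Ici
          (g := fun t => (∑ i, N.V i) * N.avgTemp (x t) - g t) (g' := fun _ => 0)
          (fun t ht => by
            refine (((hasDerivWithinAt_avgTemp (h t ht).1).const_mul _).sub
              (hg t ht)).congr_deriv ?_
            rw [(hc t ht).avgTemp, Fintype.sum_sum_type]
            simp only [Sum.elim_inl, Sum.elim_inr, electric, Pi.zero_apply, zero_mul,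
              Finset.sum_const_zero, add_zero]
            rw [hsum fun j => (x t).ω j - xs.ω j, Finset.univ_eq_empty, Finset.sum_empty]
            simp only [mul_sub, Finset.sum_sub_distrib]
            linarith) le_rfl hpos
        rw [zero_mul] at hξ
        linarith
    refine ⟨((∑ i, N.V i)⁻¹ * (l + ((∑ i, N.V i) * N.avgTemp (x 0) - g 0)), 0), ?_, ?_⟩
    · refine ((hl.add_const _).const_mul _).congr' ?_
      filter_upwards [eventually_ge_atTop 0] with t ht
      rw [← hconst t ht, add_sub_cancel, inv_mul_cancel_left₀ N.sum_V_pos.ne']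
    · exact tendsto_pi_nhds.2 fun e => isEmptyElim e
  · refine exists_tendsto_storage N.sum_V_pos N.Qh_pos N.τh_pos
      (fun t ht => hasDerivWithinAt_avgTemp (h t ht).1)
      (fun e t ht => hasDerivWithinAt_hG (h t ht).1 e)
      (fun t ht => (hc t ht).avgTemp) (fun e t ht => (hc t ht).heatSource e)
      ((tendsto_finsetSum _ fun j _ => ((hω _).const_mul _).const_mul _).sub_const _)

/-- The electric network is autonomous in this mode, so the neighbourhood restricts only angles,
frequencies and generator powers; temperatures and heat sources follow from any initial values. -/
theorem locallyConvergent_mode1 {a : N.He → ℝ} (ha : ∀ j, 0 < a j) {xs : N.State}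
    (hxs : IsEquilibrium (N.Mode1 a) xs) (hη : ∀ e, |xs.η e| < π / 2) :
    LocallyConvergent (N.Mode1 a) xs := by
  obtain ⟨V, hV, hmem, hconv⟩ := (passive₁_isRest ha hxs).exists_nhds_tendsto hη
  refine ⟨(fun x : N.State => (x.η, electric x)) ⁻¹' V, hV.preimage ?_, hmem,
    fun x₀ _ ⟨v, hv⟩ => exists_isSolution_mode1 ha hv, ?_⟩
  · refine continuous_η.prodMk (continuous_pi fun k => ?_)
    rcases k with j | g <;> simp only [electric, Sum.elim_inl, Sum.elim_inr] <;> fun_prop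
  · rintro x ⟨v, h⟩ h0
    obtain ⟨⟨η₁, hη₁⟩, hu⟩ := hconv _ _ _ (passive₁_isTrajectory ha h) h0
    have hp : ∀ t, 0 ≤ t → N.CommonEqs (x t) (v t) (fun j => a j * (x t).ω j) ∧
        ∀ j, N.Swing (x t) (v t) (fun j => a j * (x t).ω j) j := by
      intro t ht
      obtain ⟨pP, hc, hs, hp⟩ := (h t ht).2
      obtain rfl : pP = fun j : N.He => a j * (x t).ω j := funext hp
      exact ⟨hc, hs⟩
    obtain ⟨z, hθ, hhG⟩ := exists_tendsto_avgTemp_mode1 ha hxs h (fun t ht => (hp t ht).1) hη₁ hu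
    have hω : Tendsto (fun t => (x t).ω) atTop (𝓝 xs.ω) :=
      tendsto_pi_nhds.2 fun j => tendsto_pi_nhds.1 hu (.inl j)
    have hpG : Tendsto (fun t => (x t).pG) atTop (𝓝 xs.pG) :=
      tendsto_pi_nhds.2 fun g => tendsto_pi_nhds.1 hu (.inr g)
    have hpP : Tendsto (fun t (j : N.He) => a j * (x t).ω j) atTop (𝓝 fun j => a j * xs.ω j) :=
      tendsto_pi_nhds.2 fun j => (tendsto_pi_nhds.1 hω _).const_mul _
    obtain ⟨x₁, hlim, hc₁⟩ := exists_tendsto_state (fun t ht => (h t ht).1)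
      (fun t ht => (hp t ht).1) hη₁ hω hpG hhG hθ hpP
    have hω₁ : x₁.ω = xs.ω := tendsto_nhds_unique ((continuous_ω.tendsto x₁).comp hlim) hω
    exact ⟨x₁, ⟨_, hc₁, fun j => swing_of_tendsto (fun t ht => (h t ht).1)
      (fun t ht => (hp t ht).2 j) hlim hpP, fun j => by rw [hω₁]⟩, hlim⟩

/-- The passive network already yields the average temperature and the heat sources. Converter
frequencies converge as multiples of that average, and pump powers as net inflows, which are
continuous in the angles; individual temperatures are not restricted by the neighbourhood. -/
theorem locallyConvergent_mode2 {m : N.He → ℝ} {κ : ℝ} (hκ : 0 < κ) (hm : ∀ j, m j = κ * N.Co j)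
    (hdisj : Disjoint N.NeG N.He) (hne : N.EhG.Nonempty) {xs : N.State}
    (hxs : IsEquilibrium (N.Mode2 m) xs) (hη : ∀ e, |xs.η e| < π / 2) :
    LocallyConvergent (N.Mode2 m) xs := by
  obtain ⟨V, hV, hmem, hconv⟩ :=
    (passive₂_isRest hκ hdisj hne hm hxs).exists_nhds_tendsto hη
  refine ⟨(fun x : N.State => (x.η, electroThermal x)) ⁻¹' V, hV.preimage ?_, hmem,
    fun x₀ _ ⟨v, hv⟩ => exists_isSolution_mode2 hv, ?_⟩
  · refine continuous_η.prodMk (continuous_pi fun k => ?_)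
    rcases k with j | g | u | e <;> simp only [electroThermal, Sum.elim_inl, Sum.elim_inr]
    · split_ifs <;> fun_prop
    all_goals fun_prop
  · rintro x ⟨v, h⟩ h0
    obtain ⟨⟨η₁, hη₁⟩, hu⟩ := hconv _ _ _ (passive₂_isTrajectory hκ hdisj hne hm h) h0
    have hp : ∀ t, 0 ≤ t → N.CommonEqs (x t) (v t) (fun j => N.netInflow (x t) j) ∧
        (∀ j ∉ N.He, N.Swing (x t) (v t) (fun j => N.netInflow (x t) j) j) ∧
        ∀ j : N.He, (x t).ω j = m j * N.avgTemp (x t) := by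
      intro t ht
      obtain ⟨pP, hc, hs, hp⟩ := (h t ht).2
      obtain rfl : pP = fun j : N.He => N.netInflow (x t) j :=
        funext fun j => by linarith [(hp j).1]
      exact ⟨hc, hs, fun j => (hp j).2⟩
    have hθ : Tendsto (fun t => N.avgTemp (x t)) atTop (𝓝 (N.avgTemp xs)) :=
      tendsto_pi_nhds.1 hu (.inr (.inr (.inl ())))
    have hhG : Tendsto (fun t => (x t).hG) atTop (𝓝 xs.hG) :=
      tendsto_pi_nhds.2 fun e => tendsto_pi_nhds.1 hu (.inr (.inr (.inr e)))
    have hpG : Tendsto (fun t => (x t).pG) atTop (𝓝 xs.pG) :=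
      tendsto_pi_nhds.2 fun g => tendsto_pi_nhds.1 hu (.inr (.inl g))
    obtain ⟨ω₁, hω⟩ : ∃ ω₁, Tendsto (fun t => (x t).ω) atTop (𝓝 ω₁) := by
      refine ⟨fun j => if j ∈ N.He then extendZero m j * N.avgTemp xs else xs.ω j,
        tendsto_pi_nhds.2 fun j => ?_⟩
      by_cases hj : j ∈ N.He
      · simp only [hj, if_true]
        refine (hθ.const_mul _).congr' ?_
        filter_upwards [eventually_ge_atTop 0] with t ht
        rw [(hp t ht).2.2 ⟨j, hj⟩, ← extendZero_of_mem m ⟨j, hj⟩]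
      · simpa [electroThermal, hj] using tendsto_pi_nhds.1 hu (.inl j)
    have hpP : Tendsto (fun t (j : N.He) => N.netInflow (x t) j) atTop
        (𝓝 fun j : N.He => -∑ e, incidence e (j : Ne) * (N.B e * sin (η₁ e))) := by
      refine tendsto_pi_nhds.2 fun j => ?_
      simp only [netInflow_eq]
      exact (tendsto_finsetSum _ fun e _ => (((continuous_sin.tendsto _).comp
        (tendsto_pi_nhds.1 hη₁ e)).const_mul _).const_mul _).neg
    obtain ⟨x₁, hlim, hc₁⟩ := exists_tendsto_state (fun t ht => (h t ht).1)
      (fun t ht => (hp t ht).1) hη₁ hω hpG hhG hθ hpP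
    refine ⟨x₁, ⟨_, hc₁, fun j hj => swing_of_tendsto (fun t ht => (h t ht).1)
      (fun t ht => (hp t ht).2.1 j hj) hlim hpP, fun j => ⟨?_, ?_⟩⟩, hlim⟩
    · have h1 := tendsto_nhds_unique (((continuous_netInflow (N := N) j).tendsto x₁).comp hlim)
        (tendsto_pi_nhds.1 hpP j)
      rw [h1, neg_add_cancel]
    · have h1 := tendsto_pi_nhds.1 ((continuous_ω.tendsto x₁).comp hlim) j
      have h2 := ((continuous_avgTemp.tendsto x₁).comp hlim).const_mul (m j)
      refine tendsto_nhds_unique h1 (h2.congr' ?_)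
      filter_upwards [eventually_ge_atTop 0] with t ht
      exact ((hp t ht).2.2 j).symm

end CHPNetwork

theorem theorem1 {Ne Nh Eh : Type*} [Fintype Ne] [DecidableEq Ne] [Fintype Nh] [DecidableEq Nh]
    [Fintype Eh] [DecidableEq Eh] (N : CHPNetwork Ne Nh Eh) :
    (∀ a : N.He → ℝ, (∀ j, 0 < a j) →
      ∀ xs : N.State, IsEquilibrium (N.Mode1 a) xs → (∀ e, |xs.η e| < π / 2) →
        LocallyConvergent (N.Mode1 a) xs) ∧
    (∀ m : N.He → ℝ, (∀ j, 0 < m j) → (∀ i j, m i / N.Co i = m j / N.Co j) →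
      Disjoint N.NeG N.He → N.EhG.Nonempty →
      ∀ xs : N.State, IsEquilibrium (N.Mode2 m) xs → (∀ e, |xs.η e| < π / 2) →
        LocallyConvergent (N.Mode2 m) xs) := by
  refine ⟨fun a ha xs hxs hη => CHPNetwork.locallyConvergent_mode1 ha hxs hη,
    fun m hm0 hm hdisj hne xs hxs hη => ?_⟩
  -- The constant `κ` is the common ratio `m j / Co j`; without heat pumps any positive value
  -- serves.
  obtain ⟨κ, hκ, hmκ⟩ : ∃ κ, 0 < κ ∧ ∀ j, m j = κ * N.Co j := by
    rcases isEmpty_or_nonempty N.He with hE | ⟨⟨i⟩⟩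
    · exact ⟨1, one_pos, fun j => isEmptyElim j⟩
    · refine ⟨m i / N.Co i, div_pos (hm0 i) (N.Co_pos i), fun j => ?_⟩
      rw [hm i j, div_mul_cancel₀ _ (N.Co_pos j).ne']
  exact CHPNetwork.locallyConvergent_mode2 hκ hmκ hdisj hne hxs hη
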